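/- Let $n,m\ge 1$ and let $A_{n,m}$ be an annulus with $n$ marked points $v_1,\dots,v_n$ on its outer boundary and $m$ marked points $w_1,\dots,w_m$ on its inner boundary, both numbered counterclockwise. A dissection $\mathcal D$ of $A_{n,m}$ is a set of pairwise non-crossing arcs between marked points (up to homotopy, neither contractible nor boundary segments) that cut $A_{n,m}$ into polygons, called subgons; an arc may have both ends on the same boundary component. For $p\ge 3$ put $\lambda_p=2\cos(\pi/p)$. An infinite frieze pattern over $\mathbb R$ is an array $(m_{i,j})_{i,j\in\mathbb Z,\ i\le j}$ of real numbers with $m_{i,i}=0$, $m_{i,i+1}=1$ and $m_{i-1,j}\,m_{i,j+1}-m_{i,j}\,m_{i-1,j+1}=1$ for all $i\le j$. Let $\mathcal F_{out}$ be the infinite frieze pattern with $m_{i-1,i+1}=\sum_{P}\lambda_{|P|}$ for all $i\in\mathbb Z$, where the sum is over the subgons $P$ incident to $v_i$ (indices modulo $n$), each counted as often as a small half circle around $v_i$ passes through it, and $|P|$ is the number of sides of $P$. Let $\mathcal F_{in}$ be the infinite frieze pattern obtained in the same way from $w_1,\dots,w_m$ (indices modulo $m$). For an infinite frieze pattern of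 period $N$, the growth coefficients are $s_0=2$ and $s_k=m_{0,kN+1}-m_{1,kN}$ for $k\ge 1$. Write $s_k^{out}$ for those of $\mathcal F_{out}$ with $N=n$, and $s_k^{in}$ for those of $\mathcal F_{in}$ with $N=m$. **Theorem.** For every dissection $\mathcal D$ of $A_{n,m}$, the conditions above determine unique infinite frieze patterns $\mathcal F_{out}$ and $\mathcal F_{in}$, and $s_1^{in}=s_1^{out}$. Moreover, $s_k^{in}=s_k^{out}$ for all $k\ge 0$. -/

import Mathlib

/-- An infinite frieze pattern over `R`: an array `m_{i,j}` (`i, j ∈ ℤ`, `i ≤ j`). The entry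
`m_{i,i+k}` is stored as `entry i k`, so that no index `j < i` occurs. In terms of `m` the last
field is the unimodular rule `m_{i,j} m_{i+1,j+1} - m_{i+1,j} m_{i,j+1} = 1` with `j = i+k+1`,
that is, (left entry)(right entry) - (top entry)(bottom entry) = 1 for every diamond. -/
@[ext]
structure InfiniteFrieze (R : Type*) [CommRing R] where
  entry : ℤ → ℕ → R
  entry_zero : ∀ i, entry i 0 = 0
  entry_one : ∀ i, entry i 1 = 1
  unimodular : ∀ i k,
    entry i (k + 1) * entry (i + 1) (k + 1) - entry (i + 1) k * entry i (k + 2) = 1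

namespace InfiniteFrieze

variable {R : Type*} [CommRing R]

/-- The entry `m_{i,j}`, for `i ≤ j`. -/
def m (F : InfiniteFrieze R) (i j : ℤ) : R := F.entry i (j - i).toNat

/-- The quiddity row of `F` is the sequence `a`, in the indexing `a i = m_{i-1,i+1}`. -/
def HasQuiddity (F : InfiniteFrieze R) (a : ℤ → R) : Prop :=
  ∀ i, F.m (i - 1) (i + 1) = a i

/-- The growth coefficients of `F`, viewed as a pattern of period `n`: `s_0 = 2` and
`s_k = m_{0,kn+1} - m_{1,kn}` for `k ≥ 1`. -/
def growthCoeff (F : InfiniteFrieze R) (n : ℕ) : ℕ → R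
  | 0 => 2
  | k + 1 => F.m 0 ((k + 1) * n + 1) - F.m 1 ((k + 1) * n)

end InfiniteFrieze

/-- The marked points of the infinite strip: a copy of `ℤ` on the lower (outer) boundary line and
a copy of `ℤ` on the upper (inner) one, both numbered from left to right. The order is the one in
which the points are met when the boundary of the strip is traversed counterclockwise: the lower
line from left to right, then the upper line from right to left. -/
abbrev StripVertex : Type := ℤ ⊕ₗ ℤᵒᵈ

namespace StripVertex

/-- The `i`-th point of the outer boundary line. -/
def outer (i : ℤ) : StripVertex := toLex (Sum.inl i)

/-- The `j`-th point of the inner boundary line. -/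
def inner (j : ℤ) : StripVertex := toLex (Sum.inr (OrderDual.toDual j))

/-- The generator of the group of deck transformations of the strip over the annulus with `n`
outer and `m` inner marked points. -/
def shift (n m : ℕ) (v : StripVertex) : StripVertex :=
  match ofLex v with
  | Sum.inl i => outer (i + n)
  | Sum.inr j => inner (OrderDual.ofDual j + m)

/-- `a < b` are joined by a segment of the boundary of the strip. -/
def IsBoundaryEdge (a b : StripVertex) : Prop :=
  (∃ i, a = outer i ∧ b = outer (i + 1)) ∨ ∃ j, a = inner (j + 1) ∧ b = inner j

/-- For `a < b` in `P`: the points `a` and `b` are consecutive in the cyclic order of `P`, that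
is, they span a side of the polygon with vertex set `P`. -/
def IsSide (P : Finset StripVertex) (a b : StripVertex) : Prop :=
  (∀ c ∈ P, ¬(a < c ∧ c < b)) ∨ ∀ c ∈ P, a ≤ c ∧ c ≤ b

theorem outer_lt_outer {i j : ℤ} : outer i < outer j ↔ i < j := by
  simp [outer]

theorem inner_lt_inner {i j : ℤ} : inner i < inner j ↔ j < i := by
  simp [inner]

theorem outer_lt_inner (i j : ℤ) : outer i < inner j := by
  simp [outer, inner]

theorem IsBoundaryEdge.not_between {a b c : StripVertex} (h : IsBoundaryEdge a b) :
    ¬(a < c ∧ c < b) := by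
  rintro ⟨h1, h2⟩
  rcases h with ⟨i, rfl, rfl⟩ | ⟨j, rfl, rfl⟩ <;>
  · induction c using Lex.rec with
    | _ c =>
      rcases c with x | x
      · change _ < outer x at h1
        change outer x < _ at h2
        first
        | (rw [outer_lt_outer] at h1 h2; omega)
        | exact absurd h1 (outer_lt_inner _ _).not_gt
      · change _ < inner (OrderDual.ofDual x) at h1
        change inner (OrderDual.ofDual x) < _ at h2
        first
        | (rw [inner_lt_inner] at h1 h2; omega)
        | exact absurd h2 (outer_lt_inner _ _).not_gt

end StripVertex

open StripVertex in
/-- A dissection of the annulus with `n` marked points on the outer and `m` on the inner boundary,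
given by all lifts of its arcs to the universal cover, the infinite strip. A homotopy class of
arcs in the strip is a pair of marked points `a < b` that do not span a boundary segment; two such
arcs cross if and only if their end points interlace. Non-crossing arcs cut the annulus into
polygons if and only if at least one of them joins the two boundary components: otherwise some
region is not simply connected, whereas cutting along such an arc leaves a polygon, which
non-crossing diagonals cut into polygons. Arcs with both end points on the same boundary component
are allowed on either component. -/
structure AnnulusDissection (n m : ℕ) where
  /-- `arc a b` : the points `a < b` are joined by a lift of an arc of the dissection. -/
  arc : StripVertex → StripVertex → Prop
  lt_of_arc : ∀ {a b}, arc a b → a < b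
  not_boundary : ∀ {a b}, arc a b → ¬IsBoundaryEdge a b
  shift_iff : ∀ {a b}, arc (shift n m a) (shift n m b) ↔ arc a b
  noncrossing : ∀ {a b c d}, arc a b → arc c d → ¬(a < c ∧ c < b ∧ b < d)
  exists_bridging : ∃ i j, arc (outer i) (inner j)

/-- `λ_p = 2 cos (π / p)`. -/
noncomputable def friezeLambda (p : ℕ) : ℝ := 2 * Real.cos (Real.pi / p)

namespace AnnulusDissection

open StripVertex

variable {n m : ℕ} (D : AnnulusDissection n m)

/-- `a < b` are joined by an arc of the lifted dissection or by a boundary segment. -/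
def Edge (a b : StripVertex) : Prop := D.arc a b ∨ IsBoundaryEdge a b

/-- `P` is the vertex set of a subgon of the dissected strip: a polygon with at least three
vertices, all of whose sides are edges and none of whose diagonals is one. The number of sides of
the subgon is the number of elements of `P`. -/
def IsSubgon (P : Finset StripVertex) : Prop :=
  3 ≤ P.card ∧ ∀ a ∈ P, ∀ b ∈ P, a < b → (D.Edge a b ↔ IsSide P a b)

/-- The subgons of the dissected strip that are incident to `v`. A small half circle around a
marked point of the annulus lifts to one around `v`, so these correspond to the subgons that this
half circle meets, counted as often as it meets them. -/
def subgonsAt (v : StripVertex) : Set (Finset StripVertex) := {P | D.IsSubgon P ∧ v ∈ P}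

variable {D}

theorem not_cross {a b c d : StripVertex} (h : D.Edge a b) (h' : D.arc c d) :
    ¬(a < c ∧ c < b ∧ b < d) ∧ ¬(c < a ∧ a < d ∧ d < b) := by
  rcases h with h | h
  · exact ⟨D.noncrossing h h', D.noncrossing h' h⟩
  · exact ⟨fun k => h.not_between ⟨k.1, k.2.1⟩, fun k => h.not_between ⟨k.2.1, k.2.2⟩⟩

/-- The vertices of a subgon lie on one side of every arc. -/
theorem IsSubgon.not_separated {P : Finset StripVertex} (hP : D.IsSubgon P)
    {c d v p : StripVertex} (hcd : D.arc c d) (hv : v ∈ P) (hp : p ∈ P)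
    (hv' : v < c ∨ d < v) (hp' : c < p ∧ p < d) : False := by
  have hlt := D.lt_of_arc hcd
  set Q := P.filter fun x => c < x ∧ x < d with hQ
  have hQne : Q.Nonempty := ⟨p, by simp [hQ, hp, hp']⟩
  have hq : Q.min' hQne ∈ P ∧ c < Q.min' hQne ∧ Q.min' hQne < d := by
    simpa [hQ] using Q.min'_mem hQne
  have hr : Q.max' hQne ∈ P ∧ c < Q.max' hQne ∧ Q.max' hQne < d := by
    simpa [hQ] using Q.max'_mem hQne
  have hqmin : ∀ x ∈ P, c < x → x < d → Q.min' hQne ≤ x := fun x h1 h2 h3 =>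
    Q.min'_le x (by simp [hQ, h1, h2, h3])
  have hrmax : ∀ x ∈ P, c < x → x < d → x ≤ Q.max' hQne := fun x h1 h2 h3 =>
    Q.le_max' x (by simp [hQ, h1, h2, h3])
  have hPne : P.Nonempty := ⟨v, hv⟩
  generalize Q.min' hQne = q at *
  generalize Q.max' hQne = r at *
  set A := P.filter fun x => x ≤ c with hA
  set B := P.filter fun x => d ≤ x with hB
  by_cases hAne : A.Nonempty
  · by_cases hBne : B.Nonempty
    · have ha : A.max' hAne ∈ P ∧ A.max' hAne ≤ c := by simpa [hA] using A.max'_mem hAne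
      have hb : B.min' hBne ∈ P ∧ d ≤ B.min' hBne := by simpa [hB] using B.min'_mem hBne
      have hamax : ∀ x ∈ P, x ≤ c → x ≤ A.max' hAne := fun x h1 h2 =>
        A.le_max' x (by simp [hA, h1, h2])
      have hbmin : ∀ x ∈ P, d ≤ x → B.min' hBne ≤ x := fun x h1 h2 =>
        B.min'_le x (by simp [hB, h1, h2])
      generalize A.max' hAne = a at *
      generalize B.min' hBne = b at *
      have e1 : D.Edge a q := by
        refine (hP.2 a ha.1 q hq.1 (ha.2.trans_lt hq.2.1)).2 (Or.inl ?_)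
        rintro x hx ⟨h1, h2⟩
        rcases le_or_gt x c with h | h
        · exact absurd (hamax x hx h) h1.not_ge
        · exact absurd (hqmin x hx h (h2.trans hq.2.2)) h2.not_ge
      have e2 : D.Edge r b := by
        refine (hP.2 r hr.1 b hb.1 (hr.2.2.trans_le hb.2)).2 (Or.inl ?_)
        rintro x hx ⟨h1, h2⟩
        rcases le_or_gt d x with h | h
        · exact absurd (hbmin x hx h) h2.not_ge
        · exact absurd (hrmax x hx (hr.2.1.trans h1) h) h1.not_ge
      have hac : a = c := ha.2.eq_or_lt.resolve_right fun h =>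
        (not_cross e1 hcd).1 ⟨h, hq.2.1, hq.2.2⟩
      have hbd : d = b := hb.2.eq_or_lt.resolve_right fun h =>
        (not_cross e2 hcd).2 ⟨hr.2.1, hr.2.2, h⟩
      subst hac hbd
      rcases (hP.2 _ ha.1 _ hb.1 hlt).1 (Or.inl hcd) with h | h
      · exact h p hp hp'
      · rcases hv' with h' | h'
        · exact absurd (h v hv).1 h'.not_ge
        · exact absurd (h v hv).2 h'.not_ge
    · have hall : ∀ x ∈ P, x < d := fun x hx => lt_of_not_ge fun h => hBne ⟨x, by simp [hB, hx, h]⟩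
      have hvc : v < c := hv'.resolve_right fun h => absurd (hall v hv) h.not_gt
      have h1 : P.min' hPne < c := (P.min'_le v hv).trans_lt hvc
      have e : D.Edge (P.min' hPne) r := by
        refine (hP.2 _ (P.min'_mem hPne) r hr.1 (h1.trans hr.2.1)).2 (Or.inr fun x hx => ?_)
        refine ⟨P.min'_le x hx, ?_⟩
        rcases le_or_gt x c with h | h
        · exact h.trans hr.2.1.le
        · exact hrmax x hx h (hall x hx)
      exact (not_cross e hcd).1 ⟨h1, hr.2.1, hr.2.2⟩
  · have hall : ∀ x ∈ P, c < x := fun x hx => lt_of_not_ge fun h => hAne ⟨x, by simp [hA, hx, h]⟩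
    have hvd : d < v := hv'.resolve_left fun h => absurd (hall v hv) h.not_gt
    have h1 : d < P.max' hPne := hvd.trans_le (P.le_max' v hv)
    have e : D.Edge q (P.max' hPne) := by
      refine (hP.2 q hq.1 _ (P.max'_mem hPne) (hq.2.2.trans h1)).2 (Or.inr fun x hx => ?_)
      refine ⟨?_, P.le_max' x hx⟩
      rcases le_or_gt d x with h | h
      · exact hq.2.2.le.trans h
      · exact hqmin x hx (hall x hx) h
    exact (not_cross e hcd).2 ⟨hq.2.1, hq.2.2, h1⟩

theorem arc_translate {i j : ℤ} (h : D.arc (outer i) (inner j)) (k : ℤ) :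
    D.arc (outer (i + k * n)) (inner (j + k * m)) := by
  have key : ∀ k : ℤ, D.arc (outer (i + (k + 1) * n)) (inner (j + (k + 1) * m)) ↔
      D.arc (outer (i + k * n)) (inner (j + k * m)) := fun k => by
    rw [← D.shift_iff (a := outer (i + k * n))]
    simp only [shift, outer, StripVertex.inner, ofLex_toLex, OrderDual.ofDual_toDual]
    rw [show i + (k + 1) * n = i + k * n + n by ring, show j + (k + 1) * m = j + k * m + m by ring]
  induction k using Int.induction_on with
  | zero => simpa using h
  | succ k ih => exact (key _).2 ih
  | pred k ih => exact (key _).1 (by simpa using ih)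

theorem finite_subgonsAt [NeZero n] [NeZero m] (D : AnnulusDissection n m) (v : StripVertex) :
    (D.subgonsAt v).Finite := by
  classical
  obtain ⟨a, b, hab⟩ := D.exists_bridging
  have hn : (1 : ℤ) ≤ n := by exact_mod_cast NeZero.one_le
  have hm : (1 : ℤ) ≤ m := by exact_mod_cast NeZero.one_le
  obtain ⟨K, hK1, hK2⟩ : ∃ K : ℤ,
      (outer (a + (-K) * n) < v ∧ v < inner (b + (-K) * m)) ∧
      (v < outer (a + K * n) ∨ inner (b + K * m) < v) := by
    induction v using Lex.rec with
    | _ v =>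
      rcases v with x | x
      · change ∃ K : ℤ, (_ < outer x ∧ outer x < _) ∧ (outer x < _ ∨ _)
        refine ⟨|x - a| + 1, ⟨?_, outer_lt_inner _ _⟩, Or.inl ?_⟩ <;> rw [outer_lt_outer] <;>
          nlinarith [le_abs_self (x - a), neg_abs_le (x - a), abs_nonneg (x - a)]
      · change ∃ K : ℤ, (_ < inner (OrderDual.ofDual x) ∧ inner (OrderDual.ofDual x) < _) ∧
          (_ ∨ _ < inner (OrderDual.ofDual x))
        generalize OrderDual.ofDual x = x
        refine ⟨|x - b| + 1, ⟨outer_lt_inner _ _, ?_⟩, Or.inr ?_⟩ <;> rw [inner_lt_inner] <;>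
          nlinarith [le_abs_self (x - b), neg_abs_le (x - b), abs_nonneg (x - b)]
  let W : Finset StripVertex :=
    (Finset.Icc (a + (-K) * n) (a + K * n)).image outer ∪
      (Finset.Icc (b + (-K) * m) (b + K * m)).image inner
  refine (W.powerset : Finset (Finset StripVertex)).finite_toSet.subset ?_
  rintro P ⟨hP, hv⟩
  have h1 : ∀ p ∈ P, ¬(p < outer (a + (-K) * n) ∨ inner (b + (-K) * m) < p) := fun p hp h =>
    hP.not_separated (arc_translate hab (-K)) hp hv h hK1
  have h2 : ∀ p ∈ P, ¬(outer (a + K * n) < p ∧ p < inner (b + K * m)) := fun p hp h =>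
    hP.not_separated (arc_translate hab K) hv hp hK2 h
  simp only [Finset.coe_powerset, Set.mem_preimage, Set.mem_powerset_iff, Finset.coe_subset]
  intro p hp
  specialize h1 p hp
  specialize h2 p hp
  simp only [W, Finset.mem_union, Finset.mem_image, Finset.mem_Icc]
  induction p using Lex.rec with
  | _ p =>
    rcases p with x | x
    · change ¬(outer x < _ ∨ _) at h1
      change ¬(_ < outer x ∧ outer x < _) at h2
      rw [outer_lt_outer] at h1
      rw [outer_lt_outer] at h2
      refine Or.inl ⟨x, ⟨not_lt.1 fun h => h1 (Or.inl h), not_lt.1 fun h => h2 ⟨h, ?_⟩⟩, rfl⟩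
      exact outer_lt_inner _ _
    · change ¬(_ ∨ _ < inner (OrderDual.ofDual x)) at h1
      change ¬(_ < inner (OrderDual.ofDual x) ∧ inner (OrderDual.ofDual x) < _) at h2
      rw [inner_lt_inner] at h1 h2
      refine Or.inr ⟨OrderDual.ofDual x,
        ⟨not_lt.1 fun h => h1 (Or.inr h), not_lt.1 fun h => h2 ⟨?_, h⟩⟩, rfl⟩
      exact outer_lt_inner _ _

variable [NeZero n] [NeZero m] (D)

/-- The sum of `λ_{|P|}` over the subgons `P` incident to `v`. -/
noncomputable def weight (v : StripVertex) : ℝ :=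
  ∑ P ∈ (D.finite_subgonsAt v).toFinset, friezeLambda P.card

/-- `F` is a frieze pattern read from the outer boundary of the dissected annulus. -/
def IsOuterFrieze (F : InfiniteFrieze ℝ) : Prop := F.HasQuiddity fun i => D.weight (outer i)

/-- `F` is a frieze pattern read from the inner boundary of the dissected annulus. -/
def IsInnerFrieze (F : InfiniteFrieze ℝ) : Prop := F.HasQuiddity fun j => D.weight (inner j)

end AnnulusDissection

/-! The universal cover of the dissected annulus is developed into the plane with its area form. A
subgon with `p` sides becomes an affinely regular polygon: half a turn of vectors at angles `k * π /
p`, scaled so that every side spans area one. Adjacent subgons are glued along their common arc by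
an area-preserving linear map. Around a vertex of a regular `p`-gon, next vector plus previous
vector equals `λ_p` times the vector itself, with the sign conventions of `relLift`. These relations
add up over the subgons at a boundary vertex (`IsPolygon.angle_smul`), so along each boundary line
the vectors solve `f (i+1) + f (i-1) = a i • f i`, where `a` is the quiddity row.

Hence the areas `wedge (f i) (f j)` are the continuants of `a`, which form a frieze pattern with
that quiddity row (`Unrolls.wedge_eq`). By Ptolemy's relation these areas are positive
(`IsDevelopment.glue`). The entries by which the unimodular rule divides are therefore nonzero, and
the pattern is unique.

The deck transformation acts on the developed vectors by a linear map `T`. A bridging arc gives a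
frame with one vector on each boundary, and `T` is determined by sending this frame to its
translate; it is thus the same for both boundaries (`exists_unrolls`). The first growth coefficient
on either side is the trace of `T` (`Unrolls.growthCoeff_eq`). The inner line turns the other way,
which a reflection of the plane corrects without changing the trace. The higher coefficients are
first coefficients of the `k`-fold covering annulus.

Developments are built only for finite polygons, by induction on cuts along arcs. The strip is
therefore handled through regions between two distant translates of a bridging arc. -/

/-! ### Areas and linear maps of the plane -/

/-- The oriented area of the parallelogram spanned by two vectors of the plane. -/
def wedge (p q : ℝ × ℝ) : ℝ := p.1 * q.2 - p.2 * q.1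

/-- The linear map that sends the frame `(p, q)`, of area one, to `(p', q')`. -/
def frameMap (p q p' q' z : ℝ × ℝ) : ℝ × ℝ := wedge z q • p' + wedge p z • q'

theorem frameMap_left {p q : ℝ × ℝ} (h : wedge p q = 1) (p' q' : ℝ × ℝ) :
    frameMap p q p' q' p = p' := by
  have : wedge p p = 0 := by simp only [wedge]; ring
  simp [frameMap, h, this]

theorem frameMap_right {p q : ℝ × ℝ} (h : wedge p q = 1) (p' q' : ℝ × ℝ) :
    frameMap p q p' q' q = q' := by
  have : wedge q q = 0 := by simp only [wedge]; ring
  simp [frameMap, h, this]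

theorem frameMap_sub (p q p' q' y z : ℝ × ℝ) :
    frameMap p q p' q' (y - z) = frameMap p q p' q' y - frameMap p q p' q' z := by
  ext <;> simp [frameMap, wedge] <;> ring

theorem frameMap_neg (p q p' q' z : ℝ × ℝ) :
    frameMap p q p' q' (-z) = -frameMap p q p' q' z := by
  ext <;> simp [frameMap, wedge] <;> ring

theorem frameMap_smul (p q p' q' : ℝ × ℝ) (c : ℝ) (z : ℝ × ℝ) :
    frameMap p q p' q' (c • z) = c • frameMap p q p' q' z := by
  ext <;> simp [frameMap, wedge] <;> ring

theorem wedge_frameMap {p q p' q' : ℝ × ℝ} (h : wedge p q = 1) (h' : wedge p' q' = 1)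
    (y z : ℝ × ℝ) :
    wedge (frameMap p q p' q' y) (frameMap p q p' q' z) = wedge y z := by
  have : wedge (frameMap p q p' q' y) (frameMap p q p' q' z) =
      wedge p q * wedge p' q' * wedge y z := by
    simp only [wedge, frameMap, Prod.fst_add, Prod.snd_add, Prod.smul_fst, Prod.smul_snd,
      smul_eq_mul]
    ring
  rw [this, h, h', one_mul, one_mul]

/-- The factor `wedge p' q + wedge p q'` is the trace of the map: it is a sum of two rank-one maps
with these traces. The identity itself holds for every linear map of the plane and its trace. -/
theorem wedge_frameMap_add (p q p' q' y z : ℝ × ℝ) :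
    wedge y (frameMap p q p' q' z) + wedge (frameMap p q p' q' y) z =
      (wedge p' q + wedge p q') * wedge y z := by
  simp only [wedge, frameMap, Prod.fst_add, Prod.snd_add, Prod.smul_fst, Prod.smul_snd,
    smul_eq_mul]
  ring

/-- Ptolemy's relation. -/
theorem wedge_mul_wedge (p q r s : ℝ × ℝ) :
    wedge p r * wedge q s = wedge p q * wedge r s + wedge p s * wedge q r := by
  simp only [wedge]; ring

/-! ### Cyclic order and rank in a finite set -/

/-- `u` is the successor of `v` in the cyclic order of `S`. -/
def CycSucc {α : Type*} [LinearOrder α] (S : Finset α) (v u : α) : Prop :=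
  (v < u ∧ ∀ c ∈ S, ¬(v < c ∧ c < u)) ∨ (u < v ∧ ∀ c ∈ S, u ≤ c ∧ c ≤ v)

theorem CycSucc.mono {α : Type*} [LinearOrder α] {S S' : Finset α} {v u : α}
    (h : CycSucc S v u) (hS : S' ⊆ S) : CycSucc S' v u :=
  h.imp (fun h => ⟨h.1, fun c hc => h.2 c (hS hc)⟩) fun h => ⟨h.1, fun c hc => h.2 c (hS hc)⟩

/-- The number of elements of `S` below `a`. -/
def rankIn {α : Type*} [LinearOrder α] (S : Finset α) (a : α) : ℕ := (S.filter (· < a)).card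

section rank

variable {α : Type*} [LinearOrder α] {S : Finset α} {a b v u : α}

theorem rankIn_lt_rankIn (ha : a ∈ S) (h : a < b) : rankIn S a < rankIn S b := by
  refine Finset.card_lt_card ⟨fun c hc => ?_, fun hs => ?_⟩
  · simp only [Finset.mem_filter] at hc ⊢
    exact ⟨hc.1, hc.2.trans h⟩
  · have := hs (Finset.mem_filter.2 ⟨ha, h⟩)
    simp at this

theorem rankIn_lt_card (ha : a ∈ S) : rankIn S a < S.card := by
  refine Finset.card_lt_card ⟨Finset.filter_subset _ _, fun hs => ?_⟩
  have := hs ha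
  simp at this

theorem rankIn_succ (hv : v ∈ S) (h : v < u) (h' : ∀ c ∈ S, ¬(v < c ∧ c < u)) :
    rankIn S u = rankIn S v + 1 := by
  have : S.filter (· < u) = insert v (S.filter (· < v)) := by
    ext c
    simp only [Finset.mem_filter, Finset.mem_insert]
    constructor
    · rintro ⟨h1, h2⟩
      rcases lt_trichotomy c v with h3 | h3 | h3
      · exact Or.inr ⟨h1, h3⟩
      · exact Or.inl h3
      · exact absurd ⟨h3, h2⟩ (h' c h1)
    · rintro (rfl | h3)
      · exact ⟨hv, h⟩
      · exact ⟨h3.1, h3.2.trans h⟩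
  rw [rankIn, this, Finset.card_insert_of_notMem (by simp), rankIn]

theorem rankIn_eq_zero (h : ∀ c ∈ S, u ≤ c) : rankIn S u = 0 := by
  rw [rankIn, Finset.card_eq_zero, Finset.filter_eq_empty_iff]
  exact fun c hc => (h c hc).not_gt

theorem rankIn_eq_card (hv : v ∈ S) (h : ∀ c ∈ S, c ≤ v) : rankIn S v + 1 = S.card := by
  have : S.filter (· < v) = S.erase v := by
    ext c
    simp only [Finset.mem_filter, Finset.mem_erase]
    exact ⟨fun hc => ⟨hc.2.ne, hc.1⟩, fun hc => ⟨hc.2, lt_of_le_of_ne (h c hc.2) hc.1⟩⟩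
  rw [rankIn, this, Finset.card_erase_add_one hv]

end rank

/-! ### Affinely regular polygons -/

/-- The lift of `x t` that follows `x v` when the vertices are passed counterclockwise. -/
noncomputable def relLift {α : Type*} [LinearOrder α] (x : α → ℝ × ℝ) (v t : α) : ℝ × ℝ :=
  if v < t then x t else -x t

/-- `x` maps the vertices of `P` to those of an affinely regular polygon inscribed in a
conic. -/
def IsRegularOn {α : Type*} [LinearOrder α] (x : α → ℝ × ℝ) (P : Finset α) : Prop :=
  ∀ v ∈ P, ∀ u ∈ P, ∀ w ∈ P, CycSucc P v u → CycSucc P w v →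
    relLift x v u - relLift x v w = friezeLambda P.card • x v

theorem IsRegularOn.congr {α : Type*} [LinearOrder α] {x y : α → ℝ × ℝ} {P : Finset α}
    (h : IsRegularOn x P) (hxy : ∀ v ∈ P, y v = x v) : IsRegularOn y P := by
  intro v hv u hu w hw h1 h2
  have := h v hv u hu w hw h1 h2
  simpa only [relLift, hxy v hv, hxy u hu, hxy w hw] using this

theorem IsRegularOn.frameMap {α : Type*} [LinearOrder α] {x : α → ℝ × ℝ} {P : Finset α}
    (h : IsRegularOn x P) (p q p' q' : ℝ × ℝ) :
    IsRegularOn (fun v => frameMap p q p' q' (x v)) P := by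
  have key : ∀ v t, relLift (fun v => _root_.frameMap p q p' q' (x v)) v t =
      _root_.frameMap p q p' q' (relLift x v t) := by
    intro v t
    simp only [relLift]
    split_ifs
    · rfl
    · rw [frameMap_neg]
  intro v hv u hu w hw h1 h2
  rw [key, key, ← frameMap_sub, h v hv u hu w hw h1 h2, frameMap_smul]

/-- The vertices of a regular polygon, scaled so that its sides have area one. -/
noncomputable def regularVertex (p : ℕ) (k : ℤ) : ℝ × ℝ :=
  (√(Real.sin (Real.pi / p)))⁻¹ • (Real.cos (k * (Real.pi / p)), Real.sin (k * (Real.pi / p)))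

theorem sin_pi_div_pos {p : ℕ} (hp : 2 ≤ p) : 0 < Real.sin (Real.pi / p) := by
  have : (2 : ℝ) ≤ p := by exact_mod_cast hp
  apply Real.sin_pos_of_pos_of_lt_pi
  · have := Real.pi_pos; positivity
  · exact div_lt_self Real.pi_pos (by linarith)

theorem wedge_regularVertex {p : ℕ} (hp : 2 ≤ p) (k l : ℤ) :
    wedge (regularVertex p k) (regularVertex p l) =
      Real.sin ((l - k) * (Real.pi / p)) / Real.sin (Real.pi / p) := by
  have h := sin_pi_div_pos hp
  have h2 := Real.mul_self_sqrt h.le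
  have h3 : √(Real.sin (Real.pi / p)) ≠ 0 := (Real.sqrt_pos.2 h).ne'
  rw [sub_mul, Real.sin_sub]
  simp only [wedge, regularVertex, Prod.smul_fst, Prod.smul_snd, smul_eq_mul]
  rw [eq_div_iff h.ne']
  generalize √(Real.sin (Real.pi / p)) = r at *
  rw [← h2]
  field_simp

theorem regularVertex_add (p : ℕ) (k : ℤ) :
    regularVertex p (k + 1) + regularVertex p (k - 1) = friezeLambda p • regularVertex p k := by
  ext <;> simp only [regularVertex, friezeLambda, Prod.fst_add, Prod.snd_add, Prod.smul_fst,
    Prod.smul_snd, smul_eq_mul] <;> push_cast <;>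
    simp only [add_mul, sub_mul, one_mul, Real.cos_add, Real.cos_sub, Real.sin_add, Real.sin_sub]
    <;> ring

/-- Consecutive vertices are `π / p` apart, not `2π / p`, so one passage through the polygon is half
a turn. This is the source of the sign in `relLift`. -/
theorem regularVertex_add_self {p : ℕ} (hp : p ≠ 0) (k : ℤ) :
    regularVertex p (k + p) = -regularVertex p k := by
  have : (p : ℝ) ≠ 0 := by exact_mod_cast hp
  have h : ((k + p : ℤ) : ℝ) * (Real.pi / p) = k * (Real.pi / p) + Real.pi := by
    push_cast; field_simp
  simp only [regularVertex, h, Real.cos_add_pi, Real.sin_add_pi]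
  ext <;> simp

/-- Numbering the elements of `S` by their rank develops `S` as a regular polygon. -/
theorem isRegularOn_regularVertex {α : Type*} [LinearOrder α] {S : Finset α} :
    IsRegularOn (fun a => regularVertex S.card (rankIn S a)) S := by
  intro v hv u hu w hw h1 h2
  have hS : S.card ≠ 0 := (Finset.card_pos.2 ⟨v, hv⟩).ne'
  have e1 : relLift (fun a => regularVertex S.card (rankIn S a)) v u =
      regularVertex S.card (rankIn S v + 1) := by
    rcases h1 with ⟨h, h'⟩ | ⟨h, h'⟩
    · rw [relLift, if_pos h, rankIn_succ hv h h']; rfl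
    -- Here `v` is last and `u` first: the minus sign of `relLift` moves rank `0` to rank `p`, one
    -- more than the rank of `v`.
    · rw [relLift, if_neg h.not_gt, rankIn_eq_zero fun c hc => (h' c hc).1,
        ← regularVertex_add_self hS, ← rankIn_eq_card hv fun c hc => (h' c hc).2]
      simp
  have e2 : relLift (fun a => regularVertex S.card (rankIn S a)) v w =
      -regularVertex S.card (rankIn S v - 1) := by
    rcases h2 with ⟨h, h'⟩ | ⟨h, h'⟩
    · rw [relLift, if_neg h.not_gt, rankIn_succ hw h h']; simp
    · rw [relLift, if_pos h, rankIn_eq_zero fun c hc => (h' c hc).1,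
        ← regularVertex_add_self hS, ← rankIn_eq_card hw fun c hc => (h' c hc).2]
      congr 1; push_cast; ring
  rw [e1, e2, sub_neg_eq_add, regularVertex_add]

/-! ### Cutting polygons of the strip along arcs -/

namespace AnnulusDissection

open StripVertex

variable {n m : ℕ} {D : AnnulusDissection n m}

variable (D) in
/-- `S` is the vertex set of a polygon in the strip all of whose sides are edges. -/
def IsPolygon (S : Finset StripVertex) : Prop :=
  2 ≤ S.card ∧ ∀ a ∈ S, ∀ b ∈ S, a < b → IsSide S a b → D.Edge a b

/-- The vertices of `S` on the arc from `a` to `b`. -/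
def innerPart (S : Finset StripVertex) (a b : StripVertex) : Finset StripVertex :=
  S.filter fun c => a ≤ c ∧ c ≤ b

/-- The vertices of `S` that are not strictly between `a` and `b`. -/
def outerPart (S : Finset StripVertex) (a b : StripVertex) : Finset StripVertex :=
  S.filter fun c => c ≤ a ∨ b ≤ c

theorem mem_innerPart {S : Finset StripVertex} {a b c : StripVertex} :
    c ∈ innerPart S a b ↔ c ∈ S ∧ a ≤ c ∧ c ≤ b := Finset.mem_filter

theorem mem_outerPart {S : Finset StripVertex} {a b c : StripVertex} :
    c ∈ outerPart S a b ↔ c ∈ S ∧ (c ≤ a ∨ b ≤ c) := Finset.mem_filter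

theorem innerPart_subset (S : Finset StripVertex) (a b : StripVertex) : innerPart S a b ⊆ S :=
  Finset.filter_subset _ _

theorem outerPart_subset (S : Finset StripVertex) (a b : StripVertex) : outerPart S a b ⊆ S :=
  Finset.filter_subset _ _

section parts

variable {S : Finset StripVertex} {a b : StripVertex}

theorem two_le_card_of_mem (ha : a ∈ S) (hb : b ∈ S) (hab : a < b) : 2 ≤ S.card :=
  Finset.one_lt_card.2 ⟨a, ha, b, hb, hab.ne⟩

theorem isPolygon_innerPart (hS : D.IsPolygon S) (ha : a ∈ S) (hb : b ∈ S) (hab : a < b)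
    (harc : D.arc a b) : D.IsPolygon (innerPart S a b) := by
  have ha' : a ∈ innerPart S a b := mem_innerPart.2 ⟨ha, le_rfl, hab.le⟩
  have hb' : b ∈ innerPart S a b := mem_innerPart.2 ⟨hb, hab.le, le_rfl⟩
  refine ⟨two_le_card_of_mem ha' hb' hab, fun c hc d hd hcd h => ?_⟩
  have hc' := mem_innerPart.1 hc
  have hd' := mem_innerPart.1 hd
  rcases h with h | h
  · exact hS.2 c hc'.1 d hd'.1 hcd <| Or.inl fun e he hce => h e
      (mem_innerPart.2 ⟨he, hc'.2.1.trans hce.1.le, hce.2.le.trans hd'.2.2⟩) hce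
  · obtain rfl : c = a := le_antisymm (h a ha').1 hc'.2.1
    obtain rfl : d = b := le_antisymm hd'.2.2 (h b hb').2
    exact Or.inl harc

theorem isPolygon_outerPart (hS : D.IsPolygon S) (ha : a ∈ S) (hb : b ∈ S) (hab : a < b)
    (harc : D.arc a b) : D.IsPolygon (outerPart S a b) := by
  have ha' : a ∈ outerPart S a b := mem_outerPart.2 ⟨ha, Or.inl le_rfl⟩
  have hb' : b ∈ outerPart S a b := mem_outerPart.2 ⟨hb, Or.inr le_rfl⟩
  refine ⟨two_le_card_of_mem ha' hb' hab, fun c hc d hd hcd h => ?_⟩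
  have hc' := mem_outerPart.1 hc
  have hd' := mem_outerPart.1 hd
  by_cases hcase : c = a ∧ d = b
  · rw [hcase.1, hcase.2]
    exact Or.inl harc
  refine hS.2 c hc'.1 d hd'.1 hcd ?_
  rcases h with h | h
  · refine Or.inl fun e he hce => ?_
    by_cases hab' : a < e ∧ e < b
    · have h1 := h a ha'
      have h2 := h b hb'
      have h3 : c ≤ a := hc'.2.resolve_right fun h => (hce.1.trans hab'.2).not_ge h
      have h4 : b ≤ d := hd'.2.resolve_left fun h => (hab'.1.trans hce.2).not_ge h
      refine hcase ⟨h3.eq_or_lt.resolve_right fun h => h1 ⟨h, hab.trans_le h4⟩,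
        (h4.eq_or_lt.resolve_right fun h => h2 ⟨h3.trans_lt hab, h⟩).symm⟩
    · refine h e (mem_outerPart.2 ⟨he, ?_⟩) hce
      rcases le_or_gt e a with h | h
      · exact Or.inl h
      · exact Or.inr (not_lt.1 fun h' => hab' ⟨h, h'⟩)
  · refine Or.inr fun e he => ?_
    by_cases hab' : a < e ∧ e < b
    · exact ⟨(h a ha').1.trans hab'.1.le, hab'.2.le.trans (h b hb').2⟩
    · refine h e (mem_outerPart.2 ⟨he, ?_⟩)
      rcases le_or_gt e a with h | h
      · exact Or.inl h
      · exact Or.inr (not_lt.1 fun h' => hab' ⟨h, h'⟩)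

theorem card_innerPart_lt (h : ¬IsSide S a b) : (innerPart S a b).card < S.card := by
  simp only [IsSide, not_or, not_forall] at h
  obtain ⟨-, c, hc, h⟩ := h
  exact Finset.card_lt_card ⟨innerPart_subset _ _ _, fun hs => h (mem_innerPart.1 (hs hc)).2⟩

theorem card_outerPart_lt (h : ¬IsSide S a b) : (outerPart S a b).card < S.card := by
  simp only [IsSide, not_or, not_forall, not_not] at h
  obtain ⟨⟨c, hc, h⟩, -⟩ := h
  refine Finset.card_lt_card ⟨outerPart_subset _ _ _, fun hs => ?_⟩
  exact (mem_outerPart.1 (hs hc)).2.elim h.1.not_ge h.2.not_ge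

/-- A subgon lies on one side of every arc. -/
theorem IsSubgon.subset_part {P : Finset StripVertex} (hP : D.IsSubgon P) (hPS : P ⊆ S)
    (harc : D.arc a b) : P ⊆ innerPart S a b ∨ P ⊆ outerPart S a b := by
  by_contra! h
  obtain ⟨v, hv, h1⟩ := Finset.not_subset.1 h.1
  obtain ⟨p, hp, h2⟩ := Finset.not_subset.1 h.2
  rw [mem_innerPart] at h1
  rw [mem_outerPart] at h2
  refine hP.not_separated harc hv hp ?_ ?_
  · by_contra! h3
    exact h1 ⟨hPS hv, h3⟩
  · by_contra! h3
    refine h2 ⟨hPS hp, ?_⟩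
    rcases le_or_gt p a with h4 | h4
    · exact Or.inl h4
    · exact Or.inr (h3 h4)

theorem IsSubgon.not_subset_both {P : Finset StripVertex} (hP : D.IsSubgon P)
    (h1 : P ⊆ innerPart S a b) (h2 : P ⊆ outerPart S a b) :
    False := by
  have : P ⊆ {a, b} := fun p hp => by
    have h1 := mem_innerPart.1 (h1 hp)
    have h2 := mem_outerPart.1 (h2 hp)
    simp only [Finset.mem_insert, Finset.mem_singleton]
    rcases h2.2 with h | h
    · exact Or.inl (le_antisymm h h1.2.1)
    · exact Or.inr (le_antisymm h1.2.2 h)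
  have := (Finset.card_le_card this).trans Finset.card_le_two
  have := hP.1
  omega

/-- An edge between vertices of `S` lies on one side of every arc. -/
theorem Edge.mem_part {c d : StripVertex} (h : D.Edge c d) (hcd : c < d) (hc : c ∈ S)
    (hd : d ∈ S) (harc : D.arc a b) :
    (c ∈ innerPart S a b ∧ d ∈ innerPart S a b) ∨
      (c ∈ outerPart S a b ∧ d ∈ outerPart S a b) := by
  have h1 := not_cross h harc
  have := D.lt_of_arc harc
  simp only [mem_innerPart, mem_outerPart, hc, hd, true_and]
  grind

end parts

theorem arc_of_edge_of_not_isSide {S : Finset StripVertex} {a b : StripVertex}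
    (h : D.Edge a b) (hS : ¬IsSide S a b) : D.arc a b :=
  h.resolve_right fun h => hS <| Or.inl fun _ _ => h.not_between

/-- Induction on polygons by cutting along arcs. -/
theorem IsPolygon.induction {motive : Finset StripVertex → Prop}
    (base : ∀ S, D.IsPolygon S →
      (∀ a ∈ S, ∀ b ∈ S, a < b → (D.Edge a b ↔ IsSide S a b)) → motive S)
    (cut : ∀ S a b, a ∈ S → b ∈ S → a < b → D.arc a b →
      motive (innerPart S a b) → motive (outerPart S a b) →
      motive S)
    {S : Finset StripVertex} (hS : D.IsPolygon S) : motive S := by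
  induction h : S.card using Nat.strong_induction_on generalizing S with
  | _ k ih =>
    by_cases hdiag : ∀ a ∈ S, ∀ b ∈ S, a < b → D.Edge a b → IsSide S a b
    · exact base S hS fun a ha b hb hab => ⟨hdiag a ha b hb hab, hS.2 a ha b hb hab⟩
    · push Not at hdiag
      obtain ⟨a, ha, b, hb, hab, he, hside⟩ := hdiag
      -- An edge that is not a side leaves vertices of `S` on both sides, so both parts are strictly
      -- smaller.
      have harc := arc_of_edge_of_not_isSide he hside
      exact cut S a b ha hb hab harc
        (ih _ (h ▸ card_innerPart_lt hside) (isPolygon_innerPart hS ha hb hab harc) rfl)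
        (ih _ (h ▸ card_outerPart_lt hside) (isPolygon_outerPart hS ha hb hab harc) rfl)

/-- The least and greatest vertices of `P` span an edge, hence a side of `S`. Either `P` is reduced
to these two vertices, which `two` excludes, or all of `S` lies between them. -/
theorem IsSubgon.eq_of_subset_aux {S P : Finset StripVertex} {c : StripVertex}
    (hS : ∀ a ∈ S, ∀ b ∈ S, a < b → (D.Edge a b ↔ IsSide S a b)) (hP : D.IsSubgon P)
    (hPS : P ⊆ S) (two : ∀ a b, ¬∀ e ∈ P, ¬(a < e ∧ e < b) ∧ a ≤ e ∧ e ≤ b)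
    (hne : P.Nonempty) (hc : c ∈ S) : ¬((∀ e ∈ P, c < e) ∨ ∀ e ∈ P, e < c) := by
  intro hcP
  have ha := P.min'_mem hne
  have hb := P.max'_mem hne
  have hall : ∀ e ∈ P, P.min' hne ≤ e ∧ e ≤ P.max' hne := fun e he =>
    ⟨P.min'_le e he, P.le_max' e he⟩
  have hab := P.min'_lt_max'_of_card (by have := hP.1; omega)
  generalize P.max' _ = b at *
  generalize P.min' _ = a at *
  rcases (hS a (hPS ha) b (hPS hb) hab).1 ((hP.2 a ha b hb hab).2 (Or.inr hall)) with h | h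
  · exact two a b fun e he => ⟨h e (hPS he), hall e he⟩
  · rcases hcP with h' | h'
    · exact (h c hc).1.not_gt (h' a ha)
    · exact (h c hc).2.not_gt (h' b hb)

/-- A polygon without diagonals contains no subgon but itself. -/
theorem IsSubgon.eq_of_subset {S P : Finset StripVertex}
    (hS : ∀ a ∈ S, ∀ b ∈ S, a < b → (D.Edge a b ↔ IsSide S a b)) (hP : D.IsSubgon P)
    (hPS : P ⊆ S) : P = S := by
  have two : ∀ a b, ¬∀ e ∈ P, ¬(a < e ∧ e < b) ∧ a ≤ e ∧ e ≤ b := fun a b h => by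
    have : P ⊆ {a, b} := fun e he => by
      have h1 := h e he
      simp only [Finset.mem_insert, Finset.mem_singleton]
      grind
    have := (Finset.card_le_card this).trans Finset.card_le_two
    have := hP.1
    omega
  have hne : P.Nonempty := Finset.card_pos.1 (by have := hP.1; omega)
  refine Finset.Subset.antisymm hPS fun c hc => ?_
  by_contra hcP
  -- If `P` has vertices both below and above `c`, the nearest ones span a side of `P` that passes
  -- over `c`; it cannot be a side of `S`.
  by_cases hA : (P.filter (· < c)).Nonempty
  · by_cases hB : (P.filter (c < ·)).Nonempty
    · have ha := Finset.mem_filter.1 (Finset.max'_mem _ hA)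
      have hb := Finset.mem_filter.1 (Finset.min'_mem _ hB)
      have ha' : ∀ e ∈ P, e < c → e ≤ (P.filter (· < c)).max' hA := fun e he hec =>
        Finset.le_max' _ _ (Finset.mem_filter.2 ⟨he, hec⟩)
      have hb' : ∀ e ∈ P, c < e → (P.filter (c < ·)).min' hB ≤ e := fun e he hec =>
        Finset.min'_le _ _ (Finset.mem_filter.2 ⟨he, hec⟩)
      generalize (P.filter (· < c)).max' hA = a at *
      generalize (P.filter (c < ·)).min' hB = b at *
      have hno : ∀ e ∈ P, ¬(a < e ∧ e < b) := by
        rintro e he ⟨h1, h2⟩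
        rcases lt_trichotomy e c with h | rfl | h
        · exact (ha' e he h).not_gt h1
        · exact hcP he
        · exact (hb' e he h).not_gt h2
      have hab := ha.2.trans hb.2
      rcases (hS a (hPS ha.1) b (hPS hb.1) hab).1
        ((hP.2 a ha.1 b hb.1 hab).2 (Or.inl hno)) with h | h
      · exact h c hc ⟨ha.2, hb.2⟩
      · exact two a b fun e he => ⟨hno e he, h e (hPS he)⟩
    · refine hP.eq_of_subset_aux hS hPS two hne hc (Or.inr fun e he => lt_of_le_of_ne ?_ ?_)
      · exact not_lt.1 fun h => hB ⟨e, Finset.mem_filter.2 ⟨he, h⟩⟩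
      · rintro rfl; exact hcP he
  · refine hP.eq_of_subset_aux hS hPS two hne hc (Or.inl fun e he => lt_of_le_of_ne ?_ ?_)
    · exact not_lt.1 fun h => hA ⟨e, Finset.mem_filter.2 ⟨he, h⟩⟩
    · rintro rfl; exact hcP he

/-! ### Angles of polygons -/

/-- The sum of `λ_{|P|}` over the subgons `P` inside `S` that are incident to `v`. -/
noncomputable def angle (D : AnnulusDissection n m) (S : Finset StripVertex)
    (v : StripVertex) : ℝ := by
  classical exact ∑ P ∈ S.powerset with D.IsSubgon P ∧ v ∈ P, friezeLambda P.card

theorem mem_subgons_iff {S P : Finset StripVertex} {v : StripVertex}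
    [DecidablePred fun P => D.IsSubgon P ∧ v ∈ P] :
    P ∈ S.powerset.filter (fun P => D.IsSubgon P ∧ v ∈ P) ↔ P ⊆ S ∧ D.IsSubgon P ∧ v ∈ P := by
  rw [Finset.mem_filter, Finset.mem_powerset]

/-- Every subgon inside `S` lies in exactly one of the two parts, since these share at most two
vertices. -/
theorem angle_cut {S : Finset StripVertex} {a b v : StripVertex} (harc : D.arc a b) :
    D.angle S v = D.angle (innerPart S a b) v + D.angle (outerPart S a b) v := by
  classical
  unfold angle
  rw [← Finset.sum_union]
  · refine Finset.sum_congr (Finset.ext fun P => ?_) fun _ _ => rfl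
    rw [Finset.mem_union, mem_subgons_iff, mem_subgons_iff, mem_subgons_iff, ← or_and_right]
    refine and_congr_left fun h => ⟨fun h' => h.1.subset_part h' harc, fun h' => h'.elim ?_ ?_⟩
    · exact fun h' => h'.trans (innerPart_subset _ _ _)
    · exact fun h' => h'.trans (outerPart_subset _ _ _)
  · rw [Finset.disjoint_left]
    intro P h1 h2
    rw [mem_subgons_iff] at h1 h2
    exact h1.2.1.not_subset_both h1.1 h2.1

theorem angle_eq_zero {S : Finset StripVertex} {v : StripVertex} (hv : v ∉ S) :
    D.angle S v = 0 := by
  classical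
  refine Finset.sum_eq_zero fun P hP => ?_
  rw [mem_subgons_iff] at hP
  exact absurd (hP.1 hP.2.2) hv

/-- The subgons of a polygon around a vertex `v` add up to the angle of the polygon at `v`. -/
theorem IsPolygon.angle_smul {S : Finset StripVertex} (hS : D.IsPolygon S)
    {x : StripVertex → ℝ × ℝ} (hx : ∀ P ⊆ S, D.IsSubgon P → IsRegularOn x P)
    {v u w : StripVertex} (hv : v ∈ S) (hu : u ∈ S) (hw : w ∈ S)
    (hvu : CycSucc S v u) (hwv : CycSucc S w v) :
    relLift x v u - relLift x v w = D.angle S v • x v := by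
  refine hS.induction (motive := fun S => (∀ P ⊆ S, D.IsSubgon P → IsRegularOn x P) →
    ∀ v u w, v ∈ S → u ∈ S → w ∈ S → CycSucc S v u → CycSucc S w v →
      relLift x v u - relLift x v w = D.angle S v • x v) ?_ ?_ hx v u w hv hu hw hvu hwv
  · intro S hS hdiag hx v u w hv hu hw hvu hwv
    classical
    by_cases h3 : 3 ≤ S.card
    · have hsub : D.IsSubgon S := ⟨h3, hdiag⟩
      have : D.angle S v = friezeLambda S.card := by
        refine (Finset.sum_congr (s₂ := {S}) (Finset.ext fun P => ?_) fun _ _ => rfl).trans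
          (Finset.sum_singleton _ _)
        rw [mem_subgons_iff, Finset.mem_singleton]
        constructor
        · exact fun h => h.2.1.eq_of_subset hdiag h.1
        · rintro rfl
          exact ⟨subset_rfl, hsub, hv⟩
      rw [this]
      exact hx S subset_rfl hsub v hv u hu w hw hvu hwv
    -- A polygon may be a digon: it holds no subgon, and both neighbours of `v` coincide.
    · have : D.angle S v = 0 := Finset.sum_eq_zero fun P hP => by
        rw [mem_subgons_iff] at hP
        exact absurd (hP.2.1.1.trans (Finset.card_le_card hP.1)) h3
      have huw : u = w := by
        by_contra huw
        refine h3 (Finset.two_lt_card.2 ⟨v, hv, u, hu, w, hw, ?_, ?_, huw⟩)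
        · exact fun h => by rcases hvu with h' | h' <;> exact absurd h (by have := h'.1; grind)
        · exact fun h => by rcases hwv with h' | h' <;> exact absurd h (by have := h'.1; grind)
      rw [this, huw, sub_self, zero_smul]
  · intro S a b ha hb hab harc ih1 ih2 hx v u w hv hu hw hvu hwv
    specialize ih1 fun P hP => hx P (hP.trans (innerPart_subset _ _ _))
    specialize ih2 fun P hP => hx P (hP.trans (outerPart_subset _ _ _))
    have ha1 : a ∈ innerPart S a b := mem_innerPart.2 ⟨ha, le_rfl, hab.le⟩
    have hb1 : b ∈ innerPart S a b := mem_innerPart.2 ⟨hb, hab.le, le_rfl⟩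
    have ha2 : a ∈ outerPart S a b := mem_outerPart.2 ⟨ha, Or.inl le_rfl⟩
    have hb2 : b ∈ outerPart S a b := mem_outerPart.2 ⟨hb, Or.inr le_rfl⟩
    have hba : CycSucc (innerPart S a b) b a :=
      Or.inr ⟨hab, fun c hc => (mem_innerPart.1 hc).2⟩
    have hab' : CycSucc (outerPart S a b) a b :=
      Or.inl ⟨hab, fun c hc h => (mem_outerPart.1 hc).2.elim h.1.not_ge h.2.not_ge⟩
    have hvu1 := hvu.mono (innerPart_subset S a b)
    have hwv1 := hwv.mono (innerPart_subset S a b)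
    have hvu2 := hvu.mono (outerPart_subset S a b)
    have hwv2 := hwv.mono (outerPart_subset S a b)
    rw [angle_cut harc]
    by_cases hin : a < v ∧ v < b
    · have hv2 : v ∉ outerPart S a b := fun h =>
        (mem_outerPart.1 h).2.elim hin.1.not_ge hin.2.not_ge
      have hu1 : u ∈ innerPart S a b := by
        refine mem_innerPart.2 ⟨hu, ?_⟩
        unfold CycSucc at hvu; grind
      have hw1 : w ∈ innerPart S a b := by
        refine mem_innerPart.2 ⟨hw, ?_⟩
        unfold CycSucc at hwv; grind
      rw [angle_eq_zero hv2, add_zero]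
      exact ih1 _ _ _ (mem_innerPart.2 ⟨hv, hin.1.le, hin.2.le⟩) hu1 hw1 hvu1 hwv1
    -- At an end of the arc, the other end is a neighbour of `v` in both parts: successor in one and
    -- predecessor in the other. Its lift cancels when the two relations are added.
    · rcases eq_or_ne v a with rfl | hva
      · have hu1 : u ∈ innerPart S v b := by
          refine mem_innerPart.2 ⟨hu, ?_⟩
          unfold CycSucc at hvu; grind
        have hw2 : w ∈ outerPart S v b := by
          refine mem_outerPart.2 ⟨hw, ?_⟩
          unfold CycSucc at hwv; grind
        rw [add_smul, ← ih1 _ _ _ ha1 hu1 hb1 hvu1 hba, ← ih2 _ _ _ ha2 hb2 hw2 hab' hwv2]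
        abel
      · rcases eq_or_ne v b with rfl | hvb
        · have hu2 : u ∈ outerPart S a v := by
            refine mem_outerPart.2 ⟨hu, ?_⟩
            unfold CycSucc at hvu; grind
          have hw1 : w ∈ innerPart S a v := by
            refine mem_innerPart.2 ⟨hw, ?_⟩
            unfold CycSucc at hwv; grind
          rw [add_smul, ← ih1 _ _ _ hb1 ha1 hw1 hba hwv1, ← ih2 _ _ _ hb2 hu2 ha2 hvu2 hab']
          abel
        · have hv1 : v ∉ innerPart S a b := fun h => by
            have := mem_innerPart.1 h; grind
          have hv2 : v ∈ outerPart S a b := mem_outerPart.2 ⟨hv, by grind⟩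
          have hu2 : u ∈ outerPart S a b := by
            refine mem_outerPart.2 ⟨hu, ?_⟩
            unfold CycSucc at hvu; grind
          have hw2 : w ∈ outerPart S a b := by
            refine mem_outerPart.2 ⟨hw, ?_⟩
            unfold CycSucc at hwv; grind
          rw [angle_eq_zero hv1, zero_add]
          exact ih2 _ _ _ hv2 hu2 hw2 hvu2 hwv2

/-! ### Developing a dissected polygon into the plane -/

variable (D) in
/-- `x` develops the dissected polygon `S` into the plane, so that edges have area one. -/
structure IsDevelopment (S : Finset StripVertex) (x : StripVertex → ℝ × ℝ) : Prop where
  pos : ∀ a ∈ S, ∀ b ∈ S, a < b → 0 < wedge (x a) (x b)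
  edge : ∀ a ∈ S, ∀ b ∈ S, a < b → D.Edge a b → wedge (x a) (x b) = 1
  regular : ∀ P ⊆ S, D.IsSubgon P → IsRegularOn x P

theorem IsDevelopment.frameMap {S : Finset StripVertex} {x : StripVertex → ℝ × ℝ}
    (h : D.IsDevelopment S x) {p q p' q' : ℝ × ℝ} (h1 : wedge p q = 1) (h2 : wedge p' q' = 1) :
    D.IsDevelopment S fun v => frameMap p q p' q' (x v) where
  pos a ha b hb hab := by rw [wedge_frameMap h1 h2]; exact h.pos a ha b hb hab
  edge a ha b hb hab he := by rw [wedge_frameMap h1 h2]; exact h.edge a ha b hb hab he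
  regular P hP hsub := (h.regular P hP hsub).frameMap _ _ _ _

theorem IsDevelopment.congr {S : Finset StripVertex} {x y : StripVertex → ℝ × ℝ}
    (h : D.IsDevelopment S x) (hxy : ∀ v ∈ S, y v = x v) : D.IsDevelopment S y where
  pos a ha b hb hab := by rw [hxy a ha, hxy b hb]; exact h.pos a ha b hb hab
  edge a ha b hb hab he := by rw [hxy a ha, hxy b hb]; exact h.edge a ha b hb hab he
  regular P hP hsub := (h.regular P hP hsub).congr fun v hv => hxy v (hP hv)

theorem isDevelopment_regularVertex {S : Finset StripVertex} (hS : D.IsPolygon S)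
    (hdiag : ∀ a ∈ S, ∀ b ∈ S, a < b → (D.Edge a b ↔ IsSide S a b)) :
    D.IsDevelopment S fun a => regularVertex S.card (rankIn S a) where
  pos a ha b hb hab := by
    rw [wedge_regularVertex hS.1]
    refine div_pos ?_ (sin_pi_div_pos hS.1)
    have h1 : (rankIn S a : ℝ) + 1 ≤ rankIn S b := by exact_mod_cast rankIn_lt_rankIn ha hab
    have h2 : (rankIn S b : ℝ) < S.card := by exact_mod_cast rankIn_lt_card hb
    have h3 : (0 : ℝ) ≤ rankIn S a := Nat.cast_nonneg _
    have h4 : (0 : ℝ) < S.card := h3.trans_lt (by linarith)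
    have hpi := Real.pi_pos
    push_cast
    apply Real.sin_pos_of_pos_of_lt_pi
    · apply mul_pos <;> [linarith; positivity]
    · rw [mul_div_assoc', div_lt_iff₀ h4]
      nlinarith
  edge a ha b hb hab he := by
    rw [wedge_regularVertex hS.1, div_eq_one_iff_eq (sin_pi_div_pos hS.1).ne']
    rcases (hdiag a ha b hb hab).1 he with h | h
    · rw [rankIn_succ ha hab h]
      congr 1; push_cast; ring
    -- On the closing side the ranks differ by `p - 1`, and `sin (π - π / p) = sin (π / p)`.
    · have h1 : (S.card : ℝ) = rankIn S b + 1 := by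
        exact_mod_cast (rankIn_eq_card hb fun c hc => (h c hc).2).symm
      rw [rankIn_eq_zero fun c hc => (h c hc).1, ← Real.sin_pi_sub]
      have : (S.card : ℝ) ≠ 0 := by have := hS.1; positivity
      congr 1
      field_simp
      push_cast
      linarith
  regular P hP hsub := by
    rw [hsub.eq_of_subset hdiag hP]
    exact isRegularOn_regularVertex

/-- Edges and subgons never straddle the arc, so only positivity needs an argument. For `c`, `d` on
different sides, Ptolemy's relation for the quadrilateral with diagonals `ab` and `cd`, together
with area one on `ab`, writes the area of `cd` as a sum of products of positive areas. -/
theorem IsDevelopment.glue {S : Finset StripVertex} {a b : StripVertex} (ha : a ∈ S)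
    (hb : b ∈ S) (hab : a < b) (harc : D.arc a b) {x y : StripVertex → ℝ × ℝ}
    (hx : D.IsDevelopment (innerPart S a b) x) (hy : D.IsDevelopment (outerPart S a b) y)
    (hxya : x a = y a) (hxyb : x b = y b) :
    D.IsDevelopment S fun v => if a ≤ v ∧ v ≤ b then x v else y v := by
  set z : StripVertex → ℝ × ℝ := fun v => if a ≤ v ∧ v ≤ b then x v else y v with hz
  have ha1 : a ∈ innerPart S a b := mem_innerPart.2 ⟨ha, le_rfl, hab.le⟩
  have hb1 : b ∈ innerPart S a b := mem_innerPart.2 ⟨hb, hab.le, le_rfl⟩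
  have ha2 : a ∈ outerPart S a b := mem_outerPart.2 ⟨ha, Or.inl le_rfl⟩
  have hb2 : b ∈ outerPart S a b := mem_outerPart.2 ⟨hb, Or.inr le_rfl⟩
  have hz1 : D.IsDevelopment (innerPart S a b) z := hx.congr fun v hv =>
    if_pos (mem_innerPart.1 hv).2
  have hz2 : D.IsDevelopment (outerPart S a b) z := hy.congr fun v hv => by
    simp only [hz]
    split_ifs with h
    · rcases (mem_outerPart.1 hv).2 with h' | h'
      · rw [le_antisymm h' h.1, hxya]
      · rw [le_antisymm h.2 h', hxyb]
    · rfl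
  have hone := hz1.edge a ha1 b hb1 hab (Or.inl harc)
  refine ⟨fun c hc d hd hcd => ?_, fun c hc d hd hcd he => ?_, fun P hP hsub => ?_⟩
  · by_cases hc' : a < c ∧ c < b
    · have hc1 : c ∈ innerPart S a b := mem_innerPart.2 ⟨hc, hc'.1.le, hc'.2.le⟩
      rcases le_or_gt d b with hdb | hdb
      · exact hz1.pos c hc1 d (mem_innerPart.2 ⟨hd, (hc'.1.trans hcd).le, hdb⟩) hcd
      · have hd2 : d ∈ outerPart S a b := mem_outerPart.2 ⟨hd, Or.inr hdb.le⟩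
        have h1 := hz1.pos a ha1 c hc1 hc'.1
        have h2 := hz1.pos c hc1 b hb1 hc'.2
        have h3 := hz2.pos b hb2 d hd2 hdb
        have h4 := hz2.pos a ha2 d hd2 (hab.trans hdb)
        have := wedge_mul_wedge (z a) (z c) (z b) (z d)
        rw [hone, one_mul] at this
        rw [this]
        positivity
    · have hc2 : c ∈ outerPart S a b := mem_outerPart.2 ⟨hc, by grind⟩
      by_cases hd' : a < d ∧ d < b
      · have hd1 : d ∈ innerPart S a b := mem_innerPart.2 ⟨hd, hd'.1.le, hd'.2.le⟩
        rcases eq_or_ne c a with rfl | hca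
        · exact hz1.pos c ha1 d hd1 hcd
        · have hca : c < a := by grind
          have h1 := hz1.pos a ha1 d hd1 hd'.1
          have h2 := hz1.pos d hd1 b hb1 hd'.2
          have h3 := hz2.pos c hc2 a ha2 hca
          have h4 := hz2.pos c hc2 b hb2 (hca.trans hab)
          have := wedge_mul_wedge (z c) (z a) (z d) (z b)
          rw [hone, mul_one] at this
          rw [this]
          positivity
      · exact hz2.pos c hc2 d (mem_outerPart.2 ⟨hd, by grind⟩) hcd
  · rcases he.mem_part hcd hc hd harc with h | h
    · exact hz1.edge c h.1 d h.2 hcd he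
    · exact hz2.edge c h.1 d h.2 hcd he
  · rcases hsub.subset_part hP harc with h | h
    · exact hz1.regular P h hsub
    · exact hz2.regular P h hsub

theorem IsPolygon.exists_development {S : Finset StripVertex} (hS : D.IsPolygon S) :
    ∃ x, D.IsDevelopment S x := by
  refine hS.induction (motive := fun S => ∃ x, D.IsDevelopment S x)
    (fun S hS hdiag => ⟨_, isDevelopment_regularVertex hS hdiag⟩) ?_
  rintro S a b ha hb hab harc ⟨x, hx⟩ ⟨y, hy⟩
  have hx1 := hx.edge a (mem_innerPart.2 ⟨ha, le_rfl, hab.le⟩) b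
    (mem_innerPart.2 ⟨hb, hab.le, le_rfl⟩) hab (Or.inl harc)
  have hy1 := hy.edge a (mem_outerPart.2 ⟨ha, Or.inl le_rfl⟩) b
    (mem_outerPart.2 ⟨hb, Or.inr le_rfl⟩) hab (Or.inl harc)
  -- Both developments give the arc area one, so a linear map of determinant one moves the first
  -- onto the second along the arc.
  exact ⟨_, IsDevelopment.glue ha hb hab harc (hx.frameMap hx1 hy1) hy
    (frameMap_left hx1 _ _) (frameMap_right hx1 _ _)⟩

end AnnulusDissection

/-! ### Deck transformations and regions of the strip -/

namespace StripVertex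

theorem eq_outer_or_inner (v : StripVertex) : (∃ i, v = outer i) ∨ ∃ j, v = inner j := by
  induction v using Lex.rec with
  | _ v =>
    rcases v with i | j
    · exact Or.inl ⟨i, rfl⟩
    · exact Or.inr ⟨OrderDual.ofDual j, rfl⟩

theorem outer_injective : Function.Injective outer := fun i j h => by
  simpa [outer] using h

theorem inner_injective : Function.Injective inner := fun i j h => by
  simpa [inner] using h

theorem not_inner_lt_outer (i j : ℤ) : ¬inner j < outer i := (outer_lt_inner i j).not_gt

theorem outer_ne_inner (i j : ℤ) : outer i ≠ inner j := (outer_lt_inner i j).ne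

theorem shift_outer (n m : ℕ) (i : ℤ) : shift n m (outer i) = outer (i + n) := rfl

theorem shift_inner (n m : ℕ) (j : ℤ) : shift n m (inner j) = inner (j + m) := rfl

/-- The generator of the deck transformations as an order isomorphism. -/
def shiftIso (n m : ℕ) : StripVertex ≃o StripVertex :=
  OrderIso.sumLexCongr (OrderIso.addRight (n : ℤ)) (OrderIso.addRight (m : ℤ)).dual

theorem shiftIso_apply (n m : ℕ) (v : StripVertex) : shiftIso n m v = shift n m v := by
  obtain ⟨i, rfl⟩ | ⟨j, rfl⟩ := v.eq_outer_or_inner <;> rfl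

theorem shiftIso_outer (n m : ℕ) (i : ℤ) : shiftIso n m (outer i) = outer (i + n) := rfl

theorem shiftIso_inner (n m : ℕ) (j : ℤ) : shiftIso n m (inner j) = inner (j + m) := rfl

theorem isBoundaryEdge_shiftIso {n m : ℕ} {a b : StripVertex} :
    IsBoundaryEdge (shiftIso n m a) (shiftIso n m b) ↔ IsBoundaryEdge a b := by
  obtain ⟨i, rfl⟩ | ⟨i, rfl⟩ := a.eq_outer_or_inner <;>
  obtain ⟨j, rfl⟩ | ⟨j, rfl⟩ := b.eq_outer_or_inner <;>
  simp only [IsBoundaryEdge, shiftIso_outer, shiftIso_inner, outer_injective.eq_iff,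
    inner_injective.eq_iff, outer_ne_inner, (outer_ne_inner _ _).symm, false_and, and_false,
    exists_false, or_false, false_or]
  · constructor <;> rintro ⟨k, hk⟩
    · exact ⟨k - n, by omega⟩
    · exact ⟨k + n, by omega⟩
  · constructor <;> rintro ⟨k, hk⟩
    · exact ⟨k - m, by omega⟩
    · exact ⟨k + m, by omega⟩

theorem isSide_map_shiftIso {n m : ℕ} {P : Finset StripVertex} {a b : StripVertex} :
    IsSide (P.map (shiftIso n m).toEquiv.toEmbedding) (shiftIso n m a) (shiftIso n m b) ↔
      IsSide P a b := by
  simp only [IsSide, Finset.forall_mem_map]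
  exact or_congr
    (forall₂_congr fun c _ => not_congr (and_congr (OrderIso.lt_iff_lt _) (OrderIso.lt_iff_lt _)))
    (forall₂_congr fun c _ => and_congr (OrderIso.le_iff_le _) (OrderIso.le_iff_le _))

/-- The marked points between the outer points `i`, `i'` and the inner points `j`, `j'`. -/
noncomputable def region (i i' j j' : ℤ) : Finset StripVertex :=
  (Finset.Icc i i').map ⟨outer, outer_injective⟩ ∪ (Finset.Icc j j').map ⟨inner, inner_injective⟩

theorem outer_mem_region {i i' j j' k : ℤ} : outer k ∈ region i i' j j' ↔ i ≤ k ∧ k ≤ i' := by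
  simp [region, (outer_ne_inner _ _).symm]

theorem inner_mem_region {i i' j j' k : ℤ} : inner k ∈ region i i' j j' ↔ j ≤ k ∧ k ≤ j' := by
  simp [region, outer_ne_inner]

theorem region_subset {i i' j j' k k' l l' : ℤ} (h1 : k ≤ i) (h2 : i' ≤ k') (h3 : l ≤ j)
    (h4 : j' ≤ l') : region i i' j j' ⊆ region k k' l l' := by
  intro v hv
  obtain ⟨x, rfl⟩ | ⟨x, rfl⟩ := v.eq_outer_or_inner
  · rw [outer_mem_region] at hv ⊢; omega
  · rw [inner_mem_region] at hv ⊢; omega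

theorem map_region (n m : ℕ) (i i' j j' : ℤ) :
    (region i i' j j').map (shiftIso n m).toEquiv.toEmbedding =
      region (i + n) (i' + n) (j + m) (j' + m) := by
  ext v
  rw [Finset.mem_map_equiv, ← OrderIso.toEquiv_symm]
  obtain ⟨x, rfl⟩ | ⟨x, rfl⟩ := v.eq_outer_or_inner
  · have : (shiftIso n m).symm (outer x) = outer (x - n) := rfl
    erw [this]
    rw [outer_mem_region, outer_mem_region]; omega
  · have : (shiftIso n m).symm (inner x) = inner (x - m) := rfl
    erw [this]
    rw [inner_mem_region, inner_mem_region]; omega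

end StripVertex

namespace AnnulusDissection

open StripVertex

variable {n m : ℕ} {D : AnnulusDissection n m}

theorem edge_shiftIso {a b : StripVertex} :
    D.Edge (shiftIso n m a) (shiftIso n m b) ↔ D.Edge a b := by
  rw [Edge, Edge, isBoundaryEdge_shiftIso, shiftIso_apply, shiftIso_apply, D.shift_iff]

theorem isSubgon_map_shiftIso {P : Finset StripVertex} :
    D.IsSubgon (P.map (shiftIso n m).toEquiv.toEmbedding) ↔ D.IsSubgon P := by
  simp only [IsSubgon, Finset.card_map, Finset.forall_mem_map]
  refine and_congr_right fun _ => forall₂_congr fun a _ => forall₂_congr fun b _ => ?_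
  exact imp_congr (OrderIso.lt_iff_lt _) (iff_congr edge_shiftIso isSide_map_shiftIso)

theorem angle_map_shiftIso (S : Finset StripVertex) (v : StripVertex) :
    D.angle (S.map (shiftIso n m).toEquiv.toEmbedding) (shiftIso n m v) = D.angle S v := by
  classical
  symm
  unfold angle
  refine Finset.sum_bij (fun P _ => P.map (shiftIso n m).toEquiv.toEmbedding) ?_ ?_ ?_ ?_
  · intro P hP
    rw [mem_subgons_iff] at hP ⊢
    exact ⟨Finset.map_subset_map.2 hP.1, isSubgon_map_shiftIso.2 hP.2.1,
      Finset.mem_map_of_mem _ hP.2.2⟩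
  · exact fun P _ Q _ h => Finset.map_injective _ h
  · intro Q hQ
    rw [mem_subgons_iff] at hQ
    obtain ⟨P, hP, rfl⟩ := Finset.subset_map_iff.1 hQ.1
    refine ⟨P, mem_subgons_iff.2 ⟨hP, isSubgon_map_shiftIso.1 hQ.2.1, ?_⟩, rfl⟩
    exact (Finset.mem_map' (shiftIso n m).toEquiv.toEmbedding).1 hQ.2.2
  · intro P _
    rw [Finset.card_map]

/-! ### Recurrences along the boundary of a region -/

/-- Two bridging arcs and the boundary between them bound a polygon. -/
theorem isPolygon_region {i i' j j' : ℤ} (h : D.arc (outer i) (inner j))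
    (h' : D.arc (outer i') (inner j')) (hi : i ≤ i') (hj : j ≤ j') :
    D.IsPolygon (region i i' j j') := by
  have h1 : outer i ∈ region i i' j j' := outer_mem_region.2 ⟨le_rfl, hi⟩
  have h2 : inner j ∈ region i i' j j' := inner_mem_region.2 ⟨le_rfl, hj⟩
  have h3 : outer i' ∈ region i i' j j' := outer_mem_region.2 ⟨hi, le_rfl⟩
  have h4 : inner j' ∈ region i i' j j' := inner_mem_region.2 ⟨hj, le_rfl⟩
  refine ⟨two_le_card_of_mem h1 h2 (outer_lt_inner _ _), fun a ha b hb hab hs => ?_⟩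
  obtain ⟨k, rfl⟩ | ⟨k, rfl⟩ := a.eq_outer_or_inner <;>
  obtain ⟨l, rfl⟩ | ⟨l, rfl⟩ := b.eq_outer_or_inner
  · refine Or.inr (Or.inl ⟨k, rfl, ?_⟩)
    rw [outer_lt_outer] at hab
    rw [outer_mem_region] at ha hb
    rcases hs with hs | hs
    · have := hs (outer (k + 1)) (outer_mem_region.2 (by omega))
      rw [outer_lt_outer, outer_lt_outer] at this
      congr 1; omega
    · exact absurd (hs _ h2).2 (outer_lt_inner _ _).not_ge
  · rw [outer_mem_region] at ha
    rw [inner_mem_region] at hb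
    -- A side from the outer to the inner line with nothing in between is the right-hand bridging
    -- arc; one that encloses everything is the left-hand arc.
    rcases hs with hs | hs
    · have e1 := hs _ h3
      have e2 := hs _ h4
      rw [outer_lt_outer] at e1
      rw [inner_lt_inner] at e2
      have e1 : ¬k < i' := fun h => e1 ⟨h, outer_lt_inner _ _⟩
      have e2 : ¬l < j' := fun h => e2 ⟨outer_lt_inner _ _, h⟩
      obtain rfl : k = i' := by omega
      obtain rfl : l = j' := by omega
      exact Or.inl h'
    · have e1 := (hs _ h1).1
      have e2 := (hs _ h2).2
      rw [← not_lt, outer_lt_outer] at e1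
      rw [← not_lt, inner_lt_inner] at e2
      obtain rfl : k = i := by omega
      obtain rfl : l = j := by omega
      exact Or.inl h
  · exact absurd hab (not_inner_lt_outer _ _)
  · refine Or.inr (Or.inr ⟨l, ?_, rfl⟩)
    rw [inner_lt_inner] at hab
    rw [inner_mem_region] at ha hb
    rcases hs with hs | hs
    · have := hs (inner (l + 1)) (inner_mem_region.2 (by omega))
      rw [inner_lt_inner, inner_lt_inner] at this
      congr 1; omega
    · exact absurd (hs _ h1).1 (outer_lt_inner _ _).not_ge

/-- A subgon incident to an inner point of the boundary of a region lies in the region. -/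
theorem IsSubgon.subset_region {i i' j j' : ℤ} (h : D.arc (outer i) (inner j))
    (h' : D.arc (outer i') (inner j')) {P : Finset StripVertex} (hP : D.IsSubgon P)
    {v : StripVertex} (hv : v ∈ P) (h1 : outer i < v ∧ v < inner j)
    (h2 : v < outer i' ∨ inner j' < v) : P ⊆ region i i' j j' := by
  intro p hp
  have e1 : ¬(p < outer i ∨ StripVertex.inner j < p) := fun h3 => hP.not_separated h hp hv h3 h1
  have e2 : ¬(outer i' < p ∧ p < StripVertex.inner j') := fun h3 =>
    hP.not_separated h' hv hp h2 h3
  obtain ⟨k, rfl⟩ | ⟨k, rfl⟩ := p.eq_outer_or_inner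
  · simp only [outer_lt_outer, not_inner_lt_outer, outer_lt_inner, or_false, and_true] at e1 e2
    rw [outer_mem_region]; omega
  · simp only [inner_lt_inner, not_inner_lt_outer, outer_lt_inner, false_or, true_and] at e1 e2
    rw [inner_mem_region]; omega

theorem weight_eq_angle [NeZero n] [NeZero m] {S : Finset StripVertex} {v : StripVertex}
    (h : ∀ P, D.IsSubgon P → v ∈ P → P ⊆ S) : D.weight v = D.angle S v := by
  classical
  refine Finset.sum_congr (Finset.ext fun P => ?_) fun _ _ => rfl
  rw [mem_subgons_iff, Set.Finite.mem_toFinset]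
  exact ⟨fun hP => ⟨h P hP.1 hP.2, hP⟩, fun hP => hP.2⟩

/-- Strictly between the bridging arcs, every subgon at the vertex lies in the region, so the full
weight is the angle of the region there. -/
theorem weight_smul_outer [NeZero n] [NeZero m] {i i' j j' : ℤ}
    (h : D.arc (outer i) (StripVertex.inner j)) (h' : D.arc (outer i') (StripVertex.inner j'))
    (hi : i < i') (hj : j < j') {x : StripVertex → ℝ × ℝ}
    (hx : ∀ P ⊆ region i i' j j', D.IsSubgon P → IsRegularOn x P)
    {k : ℤ} (h1 : i < k) (h2 : k < i') :
    x (outer (k + 1)) + x (outer (k - 1)) = D.weight (outer k) • x (outer k) := by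
  rw [weight_eq_angle fun P hP hv => hP.subset_region h h' hv
    ⟨outer_lt_outer.2 h1, outer_lt_inner _ _⟩ (Or.inl (outer_lt_outer.2 h2))]
  have l1 : outer k < outer (k + 1) := outer_lt_outer.2 (by omega)
  have l2 : outer (k - 1) < outer k := outer_lt_outer.2 (by omega)
  have key : ∀ (k l : ℤ) (c : StripVertex), l = k + 1 → ¬(outer k < c ∧ c < outer l) := by
    rintro k l c rfl
    exact IsBoundaryEdge.not_between (Or.inl ⟨k, rfl, rfl⟩)
  have := (isPolygon_region h h' hi.le hj.le).angle_smul hx (v := outer k) (u := outer (k + 1))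
    (w := outer (k - 1)) (outer_mem_region.2 (by omega)) (outer_mem_region.2 (by omega))
    (outer_mem_region.2 (by omega)) (Or.inl ⟨l1, fun c _ => key _ _ c rfl⟩)
    (Or.inl ⟨l2, fun c _ => key _ _ c (by omega)⟩)
  rwa [relLift, relLift, if_pos l1, if_neg l2.not_gt, sub_neg_eq_add] at this

theorem weight_smul_inner [NeZero n] [NeZero m] {i i' j j' : ℤ}
    (h : D.arc (outer i) (StripVertex.inner j)) (h' : D.arc (outer i') (StripVertex.inner j'))
    (hi : i < i') (hj : j < j') {x : StripVertex → ℝ × ℝ}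
    (hx : ∀ P ⊆ region i i' j j', D.IsSubgon P → IsRegularOn x P)
    {k : ℤ} (h1 : j < k) (h2 : k < j') :
    x (StripVertex.inner (k + 1)) + x (StripVertex.inner (k - 1)) =
      D.weight (StripVertex.inner k) • x (StripVertex.inner k) := by
  rw [weight_eq_angle fun P hP hv => hP.subset_region h h' hv
    ⟨outer_lt_inner _ _, inner_lt_inner.2 h1⟩ (Or.inr (inner_lt_inner.2 h2))]
  have l1 : StripVertex.inner k < StripVertex.inner (k - 1) := inner_lt_inner.2 (by omega)
  have l2 : StripVertex.inner (k + 1) < StripVertex.inner k := inner_lt_inner.2 (by omega)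
  have key : ∀ (k l : ℤ) (c : StripVertex), l = k + 1 →
      ¬(StripVertex.inner l < c ∧ c < StripVertex.inner k) := by
    rintro k l c rfl
    exact IsBoundaryEdge.not_between (Or.inr ⟨k, rfl, rfl⟩)
  have := (isPolygon_region h h' hi.le hj.le).angle_smul hx (v := StripVertex.inner k)
    (u := StripVertex.inner (k - 1))
    (w := StripVertex.inner (k + 1)) (inner_mem_region.2 (by omega)) (inner_mem_region.2 (by omega))
    (inner_mem_region.2 (by omega)) (Or.inl ⟨l1, fun c _ => key _ _ c (by omega)⟩)
    (Or.inl ⟨l2, fun c _ => key _ _ c rfl⟩)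
  rwa [relLift, relLift, if_pos l1, if_neg l2.not_gt, sub_neg_eq_add, add_comm] at this

theorem region_between {i i' j j' : ℤ} {c : StripVertex} (hc : c ∈ region i i' j j') :
    outer i ≤ c ∧ c ≤ StripVertex.inner j := by
  obtain ⟨k, rfl⟩ | ⟨k, rfl⟩ := c.eq_outer_or_inner
  · rw [outer_mem_region] at hc
    exact ⟨not_lt.1 fun h => by rw [outer_lt_outer] at h; omega, (outer_lt_inner _ _).le⟩
  · rw [inner_mem_region] at hc
    exact ⟨(outer_lt_inner _ _).le, not_lt.1 fun h => by rw [inner_lt_inner] at h; omega⟩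

/-- At this corner the neighbour before `outer i` is `inner j`, across the bridging arc. The next
boundary vector is thus expressed in the frame of that arc, with a coefficient invariant under the
deck transformation. -/
theorem outer_add_one_eq {i i' j j' : ℤ}
    (h : D.arc (outer i) (StripVertex.inner j)) (h' : D.arc (outer i') (StripVertex.inner j'))
    (hi : i < i') (hj : j < j') {x : StripVertex → ℝ × ℝ}
    (hx : ∀ P ⊆ region i i' j j', D.IsSubgon P → IsRegularOn x P) :
    x (outer (i + 1)) = D.angle (region i i' j j') (outer i) • x (outer i) + x (StripVertex.inner j) := by
  have l1 : outer i < outer (i + 1) := outer_lt_outer.2 (by omega)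
  have l2 := outer_lt_inner i j
  have := (isPolygon_region h h' hi.le hj.le).angle_smul hx (v := outer i) (u := outer (i + 1))
    (w := StripVertex.inner j) (outer_mem_region.2 (by omega)) (outer_mem_region.2 (by omega))
    (inner_mem_region.2 (by omega))
    (Or.inl ⟨l1, fun c _ => IsBoundaryEdge.not_between (Or.inl ⟨i, rfl, rfl⟩)⟩)
    (Or.inr ⟨l2, fun c hc => region_between hc⟩)
  rw [relLift, relLift, if_pos l1, if_pos l2] at this
  rw [← this, sub_add_cancel]

theorem inner_add_one_eq {i i' j j' : ℤ}
    (h : D.arc (outer i) (StripVertex.inner j)) (h' : D.arc (outer i') (StripVertex.inner j'))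
    (hi : i < i') (hj : j < j') {x : StripVertex → ℝ × ℝ}
    (hx : ∀ P ⊆ region i i' j j', D.IsSubgon P → IsRegularOn x P) :
    x (StripVertex.inner (j + 1)) =
      D.angle (region i i' j j') (StripVertex.inner j) • x (StripVertex.inner j) + x (outer i) := by
  have l1 : StripVertex.inner (j + 1) < StripVertex.inner j := inner_lt_inner.2 (by omega)
  have l2 := outer_lt_inner i j
  have := (isPolygon_region h h' hi.le hj.le).angle_smul hx (v := StripVertex.inner j) (u := outer i)
    (w := StripVertex.inner (j + 1)) (inner_mem_region.2 (by omega)) (outer_mem_region.2 (by omega))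
    (inner_mem_region.2 (by omega))
    (Or.inr ⟨l2, fun c hc => region_between hc⟩)
    (Or.inl ⟨l1, fun c _ => IsBoundaryEdge.not_between (Or.inr ⟨j, rfl, rfl⟩)⟩)
  rw [relLift, relLift, if_neg l1.not_gt, if_neg l2.not_gt] at this
  rw [← this]
  abel

end AnnulusDissection

/-! ### Reflection of the plane; continuants and frieze patterns -/

theorem frameMap_add (p q p' q' y z : ℝ × ℝ) :
    frameMap p q p' q' (y + z) = frameMap p q p' q' y + frameMap p q p' q' z := by
  ext <;> simp [frameMap, wedge] <;> ring

/-- By increasing index, the developed inner points turn clockwise; swapping coordinates makes them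
turn counterclockwise. -/
theorem wedge_swap (p q : ℝ × ℝ) : wedge p.swap q.swap = wedge q p := by
  simp only [wedge, Prod.fst_swap, Prod.snd_swap]; ring

theorem swap_frameMap (p q p' q' z : ℝ × ℝ) :
    (frameMap p q p' q' z).swap = frameMap q.swap p.swap q'.swap p'.swap z.swap := by
  ext <;> simp only [frameMap, wedge_swap, Prod.fst_swap, Prod.snd_swap, Prod.fst_add,
    Prod.snd_add, Prod.smul_fst, Prod.smul_snd] <;> ring

/-- The solution of `m_{i,j+1} = a_j m_{i,j} - m_{i,j-1}`, as a function of `i` and `j - i`. -/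
def continuant {R : Type*} [CommRing R] (a : ℤ → R) (i : ℤ) : ℕ → R
  | 0 => 0
  | 1 => 1
  | k + 2 => a (i + k + 1) * continuant a i (k + 1) - continuant a i k

theorem continuant_unimodular {R : Type*} [CommRing R] (a : ℤ → R) (i : ℤ) (k : ℕ) :
    continuant a i (k + 1) * continuant a (i + 1) (k + 1) -
      continuant a (i + 1) k * continuant a i (k + 2) = 1 := by
  induction k with
  | zero => simp [continuant]
  | succ k ih =>
    have h1 : continuant a i (k + 3) =
        a (i + k + 2) * continuant a i (k + 2) - continuant a i (k + 1) := by
      rw [continuant]; congr 3; push_cast; ring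
    have h2 : continuant a (i + 1) (k + 2) =
        a (i + k + 2) * continuant a (i + 1) (k + 1) - continuant a (i + 1) k := by
      rw [continuant]; congr 3; ring
    rw [h1, h2]
    linear_combination ih

namespace InfiniteFrieze

/-- The frieze pattern with quiddity row `a`, built row by row. -/
def ofQuiddity {R : Type*} [CommRing R] (a : ℤ → R) : InfiniteFrieze R where
  entry := continuant a
  entry_zero _ := rfl
  entry_one _ := rfl
  unimodular := continuant_unimodular a

theorem hasQuiddity_iff {R : Type*} [CommRing R] {F : InfiniteFrieze R} {a : ℤ → R} :
    F.HasQuiddity a ↔ ∀ i, F.entry i 2 = a (i + 1) := by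
  have key : ∀ i, F.m (i - 1) (i + 1) = F.entry (i - 1) 2 := fun i => by
    rw [m, show i + 1 - (i - 1) = (2 : ℕ) by push_cast; ring, Int.toNat_natCast]
  simp only [HasQuiddity, key]
  exact ⟨fun h i => by simpa using h (i + 1), fun h i => by simpa using h (i - 1)⟩

theorem hasQuiddity_ofQuiddity {R : Type*} [CommRing R] (a : ℤ → R) :
    (ofQuiddity a).HasQuiddity a :=
  hasQuiddity_iff.2 fun i => by simp [ofQuiddity, continuant]

variable {R : Type*} [CommRing R] [IsDomain R] {F : InfiniteFrieze R} {a : ℤ → R}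

/-- The unimodular rule gives each row from the two above it, after division by an entry known to be
a nonzero continuant. -/
theorem HasQuiddity.eq_ofQuiddity (hF : F.HasQuiddity a)
    (ha : ∀ i k, continuant a i (k + 1) ≠ 0) : F = ofQuiddity a := by
  have key : ∀ k i, F.entry i k = continuant a i k := by
    intro k
    induction k using Nat.strong_induction_on with
    | _ k ih =>
      intro i
      match k with
      | 0 => exact F.entry_zero i
      | 1 => exact F.entry_one i
      | 2 => rw [hasQuiddity_iff.1 hF i]; simp [continuant]
      | k + 3 =>
        have h1 := F.unimodular i (k + 1)
        have h2 := continuant_unimodular a i (k + 1)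
        rw [ih (k + 2) (by omega), ih (k + 2) (by omega), ih (k + 1) (by omega)] at h1
        refine mul_left_cancel₀ (ha (i + 1) k) ?_
        linear_combination h2 - h1
  exact InfiniteFrieze.ext (funext fun i => funext fun k => key k i)

theorem existsUnique_hasQuiddity (ha : ∀ i k, continuant a i (k + 1) ≠ 0) :
    ∃! F : InfiniteFrieze R, F.HasQuiddity a :=
  ⟨ofQuiddity a, hasQuiddity_ofQuiddity a, fun _ hF => hF.eq_ofQuiddity ha⟩

theorem growthCoeff_one {R : Type*} [CommRing R] (F : InfiniteFrieze R) (n : ℕ) [NeZero n] :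
    F.growthCoeff n 1 = F.entry 0 (n + 1) - F.entry 1 (n - 1) := by
  have hn : 1 ≤ n := NeZero.one_le
  simp only [growthCoeff, m]
  congr 2 <;> push_cast <;> omega

/-- This reduces higher growth coefficients to the first one, for a multiple of the period. -/
theorem growthCoeff_succ {R : Type*} [CommRing R] (F : InfiniteFrieze R) (n k : ℕ) :
    F.growthCoeff n (k + 1) = F.growthCoeff ((k + 1) * n) 1 := by
  simp [growthCoeff]

end InfiniteFrieze

/-! ### Plane solutions of the recurrence and their monodromy -/

/-- Between the indices `lo` and `hi`, the sequence `f` of vectors of the plane solves the linear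
recurrence with coefficients `a`, and its entries turn counterclockwise. -/
structure Unrolls (a : ℤ → ℝ) (lo hi : ℤ) (f : ℤ → ℝ × ℝ) : Prop where
  one : ∀ i, lo ≤ i → i < hi → wedge (f i) (f (i + 1)) = 1
  pos : ∀ i j, lo ≤ i → i < j → j ≤ hi → 0 < wedge (f i) (f j)
  add : ∀ i, lo < i → i < hi → f (i + 1) + f (i - 1) = a i • f i

namespace Unrolls

variable {a : ℤ → ℝ} {lo hi : ℤ} {f : ℤ → ℝ × ℝ}

theorem mono (h : Unrolls a lo hi f) {lo' hi' : ℤ} (h1 : lo ≤ lo') (h2 : hi' ≤ hi) :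
    Unrolls a lo' hi' f :=
  ⟨fun i hi1 hi2 => h.one i (by omega) (by omega),
    fun i j hi1 hij hi2 => h.pos i j (by omega) hij (by omega),
    fun i hi1 hi2 => h.add i (by omega) (by omega)⟩

/-- Taking the area with the fixed vector `f i` turns the vector recurrence into that of the
continuant. -/
theorem wedge_eq (h : Unrolls a lo hi f) {i : ℤ} (hlo : lo ≤ i) (k : ℕ) (hk : i + k ≤ hi) :
    wedge (f i) (f (i + k)) = continuant a i k := by
  induction k using Nat.strong_induction_on with
  | _ k ih =>
    match k with
    | 0 => simp [continuant, wedge, mul_comm]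
    | 1 => simpa [continuant] using h.one i hlo (by push_cast at hk; omega)
    | k + 2 =>
      push_cast at hk
      have h1 := ih (k + 1) (by omega) (by push_cast; omega)
      have h2 := ih k (by omega) (by omega)
      have h3 := h.add (i + k + 1) (by omega) (by omega)
      rw [show i + k + 1 - 1 = i + k by ring] at h3
      rw [show i + ((k + 1 : ℕ) : ℤ) = i + k + 1 by push_cast; ring] at h1
      rw [show i + ((k + 2 : ℕ) : ℤ) = i + k + 1 + 1 by push_cast; ring, continuant, ← h1, ← h2,
        eq_sub_of_add_eq h3]
      simp only [wedge, Prod.fst_sub, Prod.snd_sub, Prod.smul_fst, Prod.smul_snd, smul_eq_mul]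
      ring

/-- The growth coefficient is the trace of the monodromy. -/
theorem growthCoeff_eq (h : Unrolls a lo hi f) {n : ℕ} [NeZero n] (hlo : lo ≤ 0)
    (hhi : (n : ℤ) + 1 ≤ hi) {p q p' q' : ℝ × ℝ} (h0 : f (0 + n) = frameMap p q p' q' (f 0))
    (h1 : f (1 + n) = frameMap p q p' q' (f 1)) :
    (InfiniteFrieze.ofQuiddity a).growthCoeff n 1 = wedge p' q + wedge p q' := by
  have hn : 1 ≤ n := NeZero.one_le
  have e0 := h.wedge_eq hlo (n + 1) (by push_cast; omega)
  have e1 := h.wedge_eq (i := 1) (by omega) (n - 1) (by omega)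
  have e2 := h.one 0 hlo (by omega)
  rw [show (0 : ℤ) + (n + 1 : ℕ) = 1 + n by push_cast; ring, h1] at e0
  rw [show (1 : ℤ) + (n - 1 : ℕ) = 0 + n by omega, h0] at e1
  rw [zero_add] at e2
  have e3 := wedge_frameMap_add p q p' q' (f 0) (f 1)
  rw [e2, mul_one] at e3
  rw [InfiniteFrieze.growthCoeff_one, ← e3]
  change continuant a 0 (n + 1) - continuant a 1 (n - 1) = _
  rw [← e0, ← e1]
  simp only [wedge]
  ring

end Unrolls

/-- Two solutions of a linear recurrence of order two agree if they agree at two consecutive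
places. -/
theorem eq_of_recurrence {c : ℤ → ℝ} {lo hi : ℤ} {f g : ℤ → ℝ × ℝ}
    (hf : ∀ i, lo < i → i < hi → f (i + 1) + f (i - 1) = c i • f i)
    (hg : ∀ i, lo < i → i < hi → g (i + 1) + g (i - 1) = c i • g i)
    (h0 : f lo = g lo) (h1 : f (lo + 1) = g (lo + 1)) {i : ℤ} (hlo : lo ≤ i) (hhi : i ≤ hi) :
    f i = g i := by
  have key : ∀ i, lo ≤ i → i ≤ hi → f i = g i ∧ (i + 1 ≤ hi → f (i + 1) = g (i + 1)) := by
    intro i hlo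
    induction i, hlo using Int.leInduction with
    | base => exact fun _ => ⟨h0, fun _ => h1⟩
    | succ i hlo ih =>
      intro hi1
      obtain ⟨ih1, ih2⟩ := ih (by omega)
      refine ⟨ih2 hi1, fun hi2 => ?_⟩
      have e1 := hf (i + 1) (by omega) (by omega)
      have e2 := hg (i + 1) (by omega) (by omega)
      rw [add_sub_cancel_right] at e1 e2
      rw [eq_sub_of_add_eq e1, eq_sub_of_add_eq e2, ih1, ih2 hi1]
  exact (key i hlo hhi).1

/-! ### Coverings, the common monodromy and the conclusion -/

namespace AnnulusDissection

open StripVertex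

theorem arc_shift_mul {n m : ℕ} (D : AnnulusDissection n m) (k : ℕ) {a b : StripVertex} :
    D.arc (shift (k * n) (k * m) a) (shift (k * n) (k * m) b) ↔ D.arc a b := by
  induction k with
  | zero =>
    have : ∀ v, shift (0 * n) (0 * m) v = v := fun v => by
      obtain ⟨i, rfl⟩ | ⟨i, rfl⟩ := v.eq_outer_or_inner <;> simp [shift_outer, shift_inner]
    rw [this, this]
  | succ k ih =>
    have : ∀ v, shift ((k + 1) * n) ((k + 1) * m) v = shift n m (shift (k * n) (k * m) v) :=
      fun v => by
        obtain ⟨i, rfl⟩ | ⟨i, rfl⟩ := v.eq_outer_or_inner <;>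
          simp [shift_outer, shift_inner, add_mul, add_assoc]
    rw [this, this, D.shift_iff, ih]

/-- The lift of a dissection of the annulus to its `k`-fold covering. -/
def cover {n m : ℕ} (D : AnnulusDissection n m) (k : ℕ) : AnnulusDissection (k * n) (k * m) where
  arc := D.arc
  lt_of_arc := D.lt_of_arc
  not_boundary := D.not_boundary
  shift_iff := D.arc_shift_mul k
  noncrossing := D.noncrossing
  exists_bridging := D.exists_bridging

variable {n m : ℕ} [NeZero n] [NeZero m] {D : AnnulusDissection n m}

theorem weight_shiftIso (v : StripVertex) : D.weight (shiftIso n m v) = D.weight v := by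
  classical
  symm
  unfold weight
  refine Finset.sum_bij (fun P _ => P.map (shiftIso n m).toEquiv.toEmbedding) ?_ ?_ ?_ ?_
  · intro P hP
    rw [Set.Finite.mem_toFinset] at hP ⊢
    exact ⟨isSubgon_map_shiftIso.2 hP.1, Finset.mem_map_of_mem _ hP.2⟩
  · exact fun P _ Q _ h => Finset.map_injective _ h
  · intro Q hQ
    rw [Set.Finite.mem_toFinset] at hQ
    have hmap : (Q.map (shiftIso n m).symm.toEquiv.toEmbedding).map
        (shiftIso n m).toEquiv.toEmbedding = Q := by
      rw [Finset.map_map]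
      convert Finset.map_refl
      ext v
      exact (shiftIso n m).apply_symm_apply v
    refine ⟨Q.map (shiftIso n m).symm.toEquiv.toEmbedding, ?_, hmap⟩
    rw [Set.Finite.mem_toFinset]
    refine ⟨isSubgon_map_shiftIso.1 (hmap.symm ▸ hQ.1), ?_⟩
    have := Finset.mem_map_of_mem (shiftIso n m).symm.toEquiv.toEmbedding hQ.2
    exact ((shiftIso n m).symm_apply_apply v) ▸ this
  · intro P _
    rw [Finset.card_map]

theorem IsDevelopment.unrolls_outer {i i' j j' : ℤ} (h : D.arc (outer i) (StripVertex.inner j))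
    (h' : D.arc (outer i') (StripVertex.inner j')) (hi : i < i') (hj : j < j')
    {x : StripVertex → ℝ × ℝ} (hx : D.IsDevelopment (region i i' j j') x) :
    Unrolls (fun k => D.weight (outer k)) i i' fun k => x (outer k) where
  one k h1 h2 := hx.edge _ (outer_mem_region.2 (by omega)) _ (outer_mem_region.2 (by omega))
    (outer_lt_outer.2 (by omega)) (Or.inr (Or.inl ⟨k, rfl, rfl⟩))
  pos k l h1 h2 h3 := hx.pos _ (outer_mem_region.2 (by omega)) _
    (outer_mem_region.2 (by omega)) (outer_lt_outer.2 h2)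
  add k h1 h2 := weight_smul_outer h h' hi hj hx.regular h1 h2

theorem IsDevelopment.unrolls_inner {i i' j j' : ℤ} (h : D.arc (outer i) (StripVertex.inner j))
    (h' : D.arc (outer i') (StripVertex.inner j')) (hi : i < i') (hj : j < j')
    {x : StripVertex → ℝ × ℝ} (hx : D.IsDevelopment (region i i' j j') x) :
    Unrolls (fun k => D.weight (StripVertex.inner k)) j j'
      fun k => (x (StripVertex.inner k)).swap where
  one k h1 h2 := by
    rw [wedge_swap]
    exact hx.edge _ (inner_mem_region.2 (by omega)) _ (inner_mem_region.2 (by omega))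
      (inner_lt_inner.2 (by omega)) (Or.inr (Or.inr ⟨k, rfl, rfl⟩))
  pos k l h1 h2 h3 := by
    rw [wedge_swap]
    exact hx.pos _ (inner_mem_region.2 (by omega)) _
      (inner_mem_region.2 (by omega)) (inner_lt_inner.2 h2)
  add k h1 h2 := by
    rw [← Prod.smul_swap, ← weight_smul_inner h h' hi hj hx.regular h1 h2, Prod.swap_add]

variable (D) in
/-- Both boundary components of an arbitrarily long part of the strip can be developed into the
plane, with the same monodromy. -/
theorem exists_unrolls (R : ℕ) : ∃ (x : StripVertex → ℝ × ℝ) (p q p' q' : ℝ × ℝ),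
    Unrolls (fun k => D.weight (outer k)) (-R) R (fun k => x (outer k)) ∧
    Unrolls (fun k => D.weight (StripVertex.inner k)) (-R) R
      (fun k => (x (StripVertex.inner k)).swap) ∧
    (∀ k : ℤ, -R ≤ k → k + n ≤ R → x (outer (k + n)) = frameMap p q p' q' (x (outer k))) ∧
    ∀ k : ℤ, -R ≤ k → k + m ≤ R →
      x (StripVertex.inner (k + m)) = frameMap p q p' q' (x (StripVertex.inner k)) := by
  have hn : (1 : ℤ) ≤ n := by exact_mod_cast NeZero.one_le
  have hm : (1 : ℤ) ≤ m := by exact_mod_cast NeZero.one_le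
  obtain ⟨i, j, h, hi, hj⟩ :
      ∃ i j : ℤ, D.arc (outer i) (StripVertex.inner j) ∧ i ≤ -R ∧ j ≤ -R := by
    obtain ⟨a, b, hab⟩ := D.exists_bridging
    refine ⟨_, _, arc_translate hab (-(|a| + |b| + R)), ?_, ?_⟩ <;>
      nlinarith [le_abs_self a, le_abs_self b, abs_nonneg a, abs_nonneg b]
  -- With `2 ≤ L` the region contains two consecutive fundamental domains, whose corners are
  -- compared below.
  obtain ⟨L, hL, hLi, hLj⟩ : ∃ L : ℤ, 2 ≤ L ∧ R ≤ i + L * n ∧ R ≤ j + L * m := by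
    refine ⟨|i| + |j| + R + 2, by linarith [abs_nonneg i, abs_nonneg j], ?_, ?_⟩ <;>
      nlinarith [neg_abs_le i, neg_abs_le j, abs_nonneg i, abs_nonneg j]
  have h1 : D.arc (outer (i + n)) (StripVertex.inner (j + m)) := by
    simpa using arc_translate h 1
  have h2 : D.arc (outer (i + n + n)) (StripVertex.inner (j + m + m)) := by
    simpa using arc_translate h1 1
  have h3 := arc_translate h L
  have hLn : i + n + n ≤ i + L * n := by nlinarith
  have hLm : j + m + m ≤ j + L * m := by nlinarith
  generalize i + L * n = i' at *
  generalize j + L * m = j' at *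
  obtain ⟨x, hx⟩ := (isPolygon_region h h3 (by omega) (by omega)).exists_development
  have hf := hx.unrolls_outer h h3 (by omega) (by omega)
  have hg := hx.unrolls_inner h h3 (by omega) (by omega)
  have hone : wedge (x (outer i)) (x (StripVertex.inner j)) = 1 :=
    hx.edge _ (outer_mem_region.2 (by omega)) _ (inner_mem_region.2 (by omega))
      (outer_lt_inner _ _) (Or.inl h)
  have hx1 : ∀ P ⊆ region i (i + n) j (j + m), D.IsSubgon P → IsRegularOn x P := fun P hP =>
    hx.regular P (hP.trans (region_subset le_rfl (by omega) le_rfl (by omega)))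
  have hx2 : ∀ P ⊆ region (i + n) (i + n + n) (j + m) (j + m + m), D.IsSubgon P →
      IsRegularOn x P := fun P hP =>
    hx.regular P (hP.trans (region_subset (by omega) (by omega) (by omega) (by omega)))
  -- The monodromy is read off the bridging arc, which has one end on each boundary; one map
  -- therefore serves both lines.
  set T := frameMap (x (outer i)) (x (StripVertex.inner j)) (x (outer (i + n)))
    (x (StripVertex.inner (j + m))) with hT
  have T0 : T (x (outer i)) = x (outer (i + n)) := frameMap_left hone _ _
  have T0' : T (x (StripVertex.inner j)) = x (StripVertex.inner (j + m)) :=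
    frameMap_right hone _ _
  have T1 : T (x (outer (i + 1))) = x (outer (i + 1 + n)) := by
    have := outer_add_one_eq h1 h2 (by omega) (by omega) hx2
    rw [← map_region, ← shiftIso_outer n m, angle_map_shiftIso, shiftIso_outer] at this
    rw [show i + 1 + (n : ℤ) = i + n + 1 by ring, this,
      outer_add_one_eq h h1 (by omega) (by omega) hx1, hT, frameMap_add, frameMap_smul, ← hT,
      T0, T0']
  have T1' : T (x (StripVertex.inner (j + 1))) = x (StripVertex.inner (j + 1 + m)) := by
    have := inner_add_one_eq h1 h2 (by omega) (by omega) hx2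
    rw [← map_region, ← shiftIso_inner n m, angle_map_shiftIso, shiftIso_inner] at this
    rw [show j + 1 + (m : ℤ) = j + m + 1 by ring, this,
      inner_add_one_eq h h1 (by omega) (by omega) hx1, hT, frameMap_add, frameMap_smul, ← hT,
      T0, T0']
  refine ⟨x, x (outer i), x (StripVertex.inner j), x (outer (i + n)),
    x (StripVertex.inner (j + m)), hf.mono hi hLi, hg.mono hj hLj, fun k hk1 hk2 => ?_,
    fun k hk1 hk2 => ?_⟩
  -- The translated sequence and the image under `T` solve the same recurrence, as weights are
  -- periodic, and agree at `i` and `i + 1`.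
  · refine eq_of_recurrence (c := fun k => D.weight (outer k)) (lo := i) (hi := i' - n)
      (f := fun k => x (outer (k + n))) (g := fun k => T (x (outer k))) ?_ ?_ T0.symm T1.symm
      (by omega) (by omega)
    · intro k hk1 hk2
      have := hf.add (k + n) (by omega) (by omega)
      simp only [← shiftIso_outer n m k, weight_shiftIso] at this
      rw [shiftIso_outer] at this
      simpa only [add_right_comm, sub_add_eq_add_sub] using this
    · intro k hk1 hk2
      simp only [hT]
      rw [← frameMap_add, ← frameMap_smul, hf.add k hk1 (by omega)]
  · refine eq_of_recurrence (c := fun k => D.weight (StripVertex.inner k)) (lo := j)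
      (hi := j' - m) (f := fun k => x (StripVertex.inner (k + m)))
      (g := fun k => T (x (StripVertex.inner k))) ?_ ?_ T0'.symm T1'.symm
      (by omega) (by omega)
    · intro k hk1 hk2
      have := weight_smul_inner h h3 (by omega) (by omega) hx.regular (k := k + m) (by omega)
        (by omega)
      rw [← shiftIso_inner n m k, weight_shiftIso, shiftIso_inner] at this
      simpa only [add_right_comm, sub_add_eq_add_sub] using this
    · intro k hk1 hk2
      simp only [hT]
      rw [← frameMap_add, ← frameMap_smul,
        weight_smul_inner h h3 (by omega) (by omega) hx.regular hk1 (by omega)]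

theorem continuant_weight_outer_pos (i : ℤ) (k : ℕ) :
    0 < continuant (fun i => D.weight (outer i)) i (k + 1) := by
  obtain ⟨x, p, q, p', q', hf, -⟩ := D.exists_unrolls (i.natAbs + k + 1)
  rw [← hf.wedge_eq (by omega) _ (by omega)]
  exact hf.pos _ _ (by omega) (by omega) (by omega)

theorem continuant_weight_inner_pos (i : ℤ) (k : ℕ) :
    0 < continuant (fun i => D.weight (StripVertex.inner i)) i (k + 1) := by
  obtain ⟨x, p, q, p', q', -, hf, -⟩ := D.exists_unrolls (i.natAbs + k + 1)
  rw [← hf.wedge_eq (by omega) _ (by omega)]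
  exact hf.pos _ _ (by omega) (by omega) (by omega)

variable (D) in
theorem growthCoeff_one_eq :
    (InfiniteFrieze.ofQuiddity fun i => D.weight (StripVertex.inner i)).growthCoeff m 1 =
      (InfiniteFrieze.ofQuiddity fun i => D.weight (outer i)).growthCoeff n 1 := by
  -- The window must reach `n + 1` on the outer and `m + 1` on the inner line.
  obtain ⟨x, p, q, p', q', hf, hg, hf', hg'⟩ := D.exists_unrolls (n + m + 1)
  have hg'' : ∀ k : ℤ, -(n + m + 1 : ℕ) ≤ k → k + m ≤ (n + m + 1 : ℕ) →
      (x (StripVertex.inner (k + m))).swap =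
        frameMap q.swap p.swap q'.swap p'.swap (x (StripVertex.inner k)).swap := fun k h1 h2 => by
    rw [hg' k h1 h2, swap_frameMap]
  rw [hf.growthCoeff_eq (by omega) (by push_cast; omega)
    (hf' 0 (by omega) (by push_cast; omega)) (hf' 1 (by omega) (by push_cast; omega)),
    hg.growthCoeff_eq (by omega) (by push_cast; omega)
    (hg'' 0 (by omega) (by push_cast; omega)) (hg'' 1 (by omega) (by push_cast; omega)),
    wedge_swap, wedge_swap, add_comm]

/-- Weights depend only on the arcs in the strip, which the annulus and its coverings share. -/
theorem weight_cover (D : AnnulusDissection n m) (k : ℕ) [NeZero (k * n)] [NeZero (k * m)]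
    (v : StripVertex) : (D.cover k).weight v = D.weight v := rfl

end AnnulusDissection

theorem mainTheorem6 (n m : ℕ) [NeZero n] [NeZero m] (D : AnnulusDissection n m) :
    (∃! F : InfiniteFrieze ℝ, D.IsOuterFrieze F) ∧
    (∃! F : InfiniteFrieze ℝ, D.IsInnerFrieze F) ∧
    ∀ F_out F_in : InfiniteFrieze ℝ, D.IsOuterFrieze F_out → D.IsInnerFrieze F_in →
      F_in.growthCoeff m 1 = F_out.growthCoeff n 1 ∧
      ∀ k : ℕ, F_in.growthCoeff m k = F_out.growthCoeff n k := by
  have h_out := fun i k => (D.continuant_weight_outer_pos i k).ne'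
  have h_in := fun i k => (D.continuant_weight_inner_pos i k).ne'
  refine ⟨InfiniteFrieze.existsUnique_hasQuiddity h_out,
    InfiniteFrieze.existsUnique_hasQuiddity h_in, fun F_out F_in ho hi => ?_⟩
  rw [InfiniteFrieze.HasQuiddity.eq_ofQuiddity ho h_out,
    InfiniteFrieze.HasQuiddity.eq_ofQuiddity hi h_in]
  refine ⟨D.growthCoeff_one_eq, fun k => ?_⟩
  cases k with
  | zero => rfl
  | succ k =>
    have : NeZero ((k + 1) * n) := ⟨mul_ne_zero k.succ_ne_zero (NeZero.ne n)⟩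
    have : NeZero ((k + 1) * m) := ⟨mul_ne_zero k.succ_ne_zero (NeZero.ne m)⟩
    rw [InfiniteFrieze.growthCoeff_succ _ m, InfiniteFrieze.growthCoeff_succ _ n]
    simpa only [AnnulusDissection.weight_cover] using (D.cover (k + 1)).growthCoeff_one_eq
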